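/- Let $(\Omega,\mathcal F,(\mathcal F_t)_{t\ge 0},\mathbf P)$ be a filtered probability space carrying a space-time white noise $W$ on $[0,\infty)\times\mathbf R$ relative to $(\mathcal F_t)$: the Wiener integrals $W(\varphi)=\int\varphi(s,y)\,W(dy\,ds)$, $\varphi\in L^2([0,\infty)\times\mathbf R)$, form a centered Gaussian family with $\mathbf E[W(\varphi)W(\psi)]=\langle\varphi,\psi\rangle_{L^2}$; $W(\varphi)$ is $\mathcal F_t$-measurable if $\varphi$ vanishes a.e. after time $t$; and the $W(\varphi)$ with $\varphi$ vanishing a.e. up to time $t$ are jointly independent of $\mathcal F_t$. Let $\sigma>0$, let $u_0:\mathbf R\to[0,\infty)$ be continuous, and let $b:\mathbf R\to[0,\infty)$ be locally Lipschitz and nondecreasing on $(0,\infty)$. Consider the equation $$\partial_t u(t,x)=\Delta u(t,x)+b(u(t,x))+\sigma\dot W(t,x),\qquad x\in\mathbf R,\ t>0,\qquad u(0,x)=u_0(x).$$ A local (mild, random field) solution up to a stopping time $\tau$ with values in $[0,\infty]$ is a jointly measurable process $u=\{u(t,x)\}_{t\ge 0,\,x\in\mathbf R}$ with real values, adapted to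 $(\mathcal F_t)$, such that for every $t>0$ and $x\in\mathbf R$, almost surely on $\{t<\tau\}$, the two Lebesgue integrals below converge absolutely and $$u(t,x)=\int_{\mathbf R}G(t,x,y)u_0(y)\,dy+\int_0^t\!\int_{\mathbf R}G(t-s,x,y)\,b(u(s,y))\,dy\,ds+\sigma\int_0^t\!\int_{\mathbf R}G(t-s,x,y)\,W(dy\,ds),$$ where $G(t,x,y)=(4\pi t)^{-1/2}e^{-(x-y)^2/(4t)}$. It is a global solution on the event $\{\tau=\infty\}$. If $b$ satisfies the Osgood condition, that is, $\int_a^\infty\frac{ds}{b(s)}<\infty$ for some $a>0$ (with $1/0=\infty$), then almost surely there is no global solution: every local solution $(u,\tau)$ satisfies $\tau<\infty$ almost surely. In particular (taking $\tau\equiv\infty$), no global solution exists. In particular, there is no Fujita exponent: for every $\eta>0$, every continuous $u_0\ge 0$, and every locally Lipschitz $b:\mathbf R\to[0,\infty)$ with $b(r)=r^{1+\eta}$ for all $r\ge 0$, almost surely there is no global solution, in the same sense. -/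

import Mathlib

open MeasureTheory ProbabilityTheory Set
open scoped NNReal ENNReal

noncomputable section

namespace StochasticHeat

/-- The heat kernel of the Laplacian on the real line,
`G(t, x, y) = (4 π t)^(-1/2) exp (-(x - y)² / (4 t))` for `t > 0`. -/
def heatKernel (t x y : ℝ) : ℝ :=
  (√(4 * Real.pi * t))⁻¹ * Real.exp (-(x - y) ^ 2 / (4 * t))

/-- Lebesgue measure on `[0, ∞) × ℝ` (first coordinate: time). -/
def spaceTime : Measure (ℝ × ℝ) :=
  ((volume : Measure ℝ).restrict (Ici 0)).prod volume

/-- The integrand `(s, y) ↦ 1_{0 < s < t} G(t - s, x, y)` of the stochastic convolution. -/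
def convKernel (t x : ℝ) : ℝ × ℝ → ℝ :=
  (Ioo 0 t ×ˢ univ).indicator fun p => heatKernel (t - p.1) x p.2

lemma measurable_convKernel (t x : ℝ) : Measurable (convKernel t x) := by
  unfold convKernel heatKernel
  refine Measurable.indicator ?_ (measurableSet_Ioo.prod MeasurableSet.univ)
  fun_prop

lemma sq_heatKernel {r : ℝ} (hr : 0 < r) (x y : ℝ) :
    heatKernel r x y ^ 2 = (4 * Real.pi * r)⁻¹ * Real.exp (-(1 / (2 * r)) * (y - x) ^ 2) := by
  unfold heatKernel
  rw [mul_pow, inv_pow, Real.sq_sqrt (by positivity), ← Real.exp_nat_mul]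
  congr 2
  field_simp
  ring

/-- The heat kernel on `(0, t) × ℝ` is square integrable, so that its Wiener integral makes
sense. -/
lemma memLp_convKernel (t x : ℝ) : MemLp (convKernel t x) 2 spaceTime := by
  have hm := measurable_convKernel t x
  rw [memLp_two_iff_integrable_sq hm.aestronglyMeasurable]
  unfold spaceTime
  have key : ∀ s ∈ Ioo 0 t, ∀ y, convKernel t x (s, y) ^ 2
      = (4 * Real.pi * (t - s))⁻¹ * Real.exp (-(1 / (2 * (t - s))) * (y - x) ^ 2) := by
    intro s hs y
    rw [← sq_heatKernel (sub_pos.2 hs.2)]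
    simp [convKernel, hs.1, hs.2]
  have key0 : ∀ s ∉ Ioo 0 t, ∀ y, convKernel t x (s, y) ^ 2 = 0 := by
    intro s hs y
    have : (s, y) ∉ Ioo 0 t ×ˢ (univ : Set ℝ) := fun h => hs h.1
    simp [convKernel, indicator_of_notMem this]
  rw [integrable_prod_iff (hm.pow_const 2).aestronglyMeasurable]
  constructor
  · refine Filter.Eventually.of_forall fun s => ?_
    by_cases hs : s ∈ Ioo 0 t
    · simp_rw [key s hs]
      have h : 0 < 1 / (2 * (t - s)) := by
        have := sub_pos.2 hs.2
        positivity
      exact ((integrable_exp_neg_mul_sq h).comp_sub_right x).const_mul _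
    · simp_rw [key0 s hs]
      exact integrable_zero _ _ _
  · have hint : (fun s => ∫ y, ‖convKernel t x (s, y) ^ 2‖)
        = (Ioo 0 t).indicator fun s =>
          (√(2 * Real.pi) / (4 * Real.pi)) * (t - s) ^ (-(1 / 2) : ℝ) := by
      funext s
      by_cases hs : s ∈ Ioo 0 t
      · have hr := sub_pos.2 hs.2
        simp_rw [Real.norm_of_nonneg (sq_nonneg _), key s hs]
        rw [integral_const_mul,
          integral_sub_right_eq_self (fun y => Real.exp (-(1 / (2 * (t - s))) * y ^ 2)) x,
          integral_gaussian, indicator_of_mem hs, Real.rpow_neg hr.le, ← Real.sqrt_eq_rpow,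
          show Real.pi / (1 / (2 * (t - s))) = (2 * Real.pi) * (t - s) by field_simp,
          Real.sqrt_mul (by positivity)]
        have h2 : √(t - s) * √(t - s) = t - s := Real.mul_self_sqrt hr.le
        have h3 : 0 < √(t - s) := Real.sqrt_pos.2 hr
        rw [show (4 * Real.pi * (t - s)) = 4 * Real.pi * (√(t - s) * √(t - s)) by rw [h2]]
        field_simp
      · simp_rw [key0 s hs]
        simp [indicator_of_notMem hs]
    rw [hint]
    refine Integrable.mono_measure ?_ Measure.restrict_le_self
    rw [integrable_indicator_iff measurableSet_Ioo]
    refine Integrable.const_mul ?_ _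
    rcases le_or_gt t 0 with ht | ht
    · simp [Ioo_eq_empty_of_le ht]
    · have h := (intervalIntegral.intervalIntegrable_rpow' (a := 0) (b := t)
        (r := (-(1 / 2) : ℝ)) (by norm_num)).comp_sub_left t
      rw [sub_zero, sub_self] at h
      exact ((intervalIntegrable_iff_integrableOn_Ioo_of_le ht.le).1 h.symm)

variable {Ω : Type*} {mΩ : MeasurableSpace Ω}

/-- Space-time white noise on `[0, ∞) × ℝ`, given by its Wiener integrals
`W φ = ∫ φ(s, y) W(dy ds)` for `φ ∈ L²([0, ∞) × ℝ)`: a centered Gaussian family with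
`E[W φ W ψ] = ⟨φ, ψ⟩`, which is moreover a white noise relative to the filtration `ℱ`:
the noise before time `t` is `ℱ t`-measurable and the noise after time `t` is
independent of `ℱ t`. -/
structure IsWhiteNoise (W : Lp ℝ 2 spaceTime → Ω → ℝ) (ℱ : Filtration ℝ≥0 mΩ)
    (P : Measure Ω) : Prop where
  measurable : ∀ φ, Measurable (W φ)
  gaussian : IsGaussianProcess W P
  centered : ∀ φ, ∫ ω, W φ ω ∂P = 0
  covariance : ∀ φ ψ, ∫ ω, W φ ω * W ψ ω ∂P = inner ℝ φ ψ
  adapted : ∀ (t : ℝ≥0) (φ : Lp ℝ 2 spaceTime),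
    (∀ᵐ p ∂spaceTime, (t : ℝ) < p.1 → φ p = 0) → Measurable[ℱ t] (W φ)
  indep : ∀ t : ℝ≥0,
    Indep (⨆ φ ∈ {φ : Lp ℝ 2 spaceTime | ∀ᵐ p ∂spaceTime, p.1 ≤ (t : ℝ) → φ p = 0},
      (borel ℝ).comap (W φ)) (ℱ t) P

/-- The stochastic convolution `∫₀ᵗ ∫_ℝ G(t - s, x, y) W(dy ds)`. -/
def stochConv (W : Lp ℝ 2 spaceTime → Ω → ℝ) (t x : ℝ) : Ω → ℝ :=
  W ((memLp_convKernel t x).toLp (convKernel t x))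

/-- The mild equation at the point `(t, x)`, along a given `ω`:
`u(t,x) = ∫ G(t,x,y) u₀(y) dy + ∫₀ᵗ ∫ G(t-s,x,y) b(u(s,y)) dy ds + σ z`,
where `v` is the path of `u` and `z` the value of the stochastic convolution.
The two Lebesgue integrals are required to converge absolutely. -/
def MildEquationAt (σ : ℝ) (b u₀ : ℝ → ℝ) (v : ℝ≥0 → ℝ → ℝ) (z : ℝ) (t : ℝ≥0) (x : ℝ) : Prop :=
  Integrable (fun y => heatKernel t x y * u₀ y) ∧
  IntegrableOn (fun p : ℝ × ℝ => heatKernel (t - p.1) x p.2 * b (v p.1.toNNReal p.2))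
    (Ioo 0 (t : ℝ) ×ˢ univ) ∧
  v t x = (∫ y, heatKernel t x y * u₀ y)
    + (∫ s in (0 : ℝ)..t, ∫ y, heatKernel (t - s) x y * b (v s.toNNReal y))
    + σ * z

/-- `u` is a local random field solution up to the stopping time `τ` of
`∂ₜ u = Δ u + b(u) + σ Ẇ` on `ℝ` with `u(0, ·) = u₀`. The value `τ = ⊤` is allowed. -/
structure IsLocalSolution (W : Lp ℝ 2 spaceTime → Ω → ℝ) (ℱ : Filtration ℝ≥0 mΩ)
    (P : Measure Ω) (σ : ℝ) (b u₀ : ℝ → ℝ) (u : ℝ≥0 → ℝ → Ω → ℝ) (τ : Ω → WithTop ℝ≥0) :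
    Prop where
  stopping : IsStoppingTime ℱ τ
  measurable : Measurable fun p : ℝ≥0 × ℝ × Ω => u p.1 p.2.1 p.2.2
  adapted : ∀ x, Adapted ℱ fun t => u t x
  mild : ∀ (t : ℝ≥0), 0 < t → ∀ x : ℝ, ∀ᵐ ω ∂P, (t : WithTop ℝ≥0) < τ ω →
    MildEquationAt σ b u₀ (fun s y => u s y ω) (stochConv W t x ω) t x

/-- Almost surely, there is no global solution: a local solution, up to whatever stopping time
`τ`, has `τ < ∞` almost surely. -/
def AlmostSurelyNoGlobalSolution (W : Lp ℝ 2 spaceTime → Ω → ℝ) (ℱ : Filtration ℝ≥0 mΩ)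
    (P : Measure Ω) (σ : ℝ) (b u₀ : ℝ → ℝ) : Prop :=
  ∀ (u : ℝ≥0 → ℝ → Ω → ℝ) (τ : Ω → WithTop ℝ≥0),
    IsLocalSolution W ℱ P σ b u₀ u τ → ∀ᵐ ω ∂P, τ ω < ⊤

/-- The Osgood condition `∫_a^∞ ds / b(s) < ∞` for some `a > 0`, with `1 / 0 = ∞`. -/
def Osgood (b : ℝ → ℝ) : Prop :=
  ∃ a : ℝ, 0 < a ∧ ∫⁻ s in Ioi a, (ENNReal.ofReal (b s))⁻¹ < ∞

end StochasticHeat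

end

/-!
The noise makes the solution large somewhere on the infinite line, however short the time elapsed
since the start. Let `0 < t₀ < t₁ ≤ 1`, and suppose that the event `B = {t₁ < τ}` has positive
probability. The indicators `eₙ` of the boxes `(0, t₀/2) × (n, n + 1)` are orthogonal with equal
norms, so the events `{W eₙ ≥ R}` are independent with equal probabilities, and by Bessel's
inequality they are asymptotically independent of `B`. On `[t₀, t₁) × [n, n + 1)` the stochastic
convolution is at least `c W eₙ` plus the part of the noise orthogonal to `eₙ`; the latter is
independent of `W eₙ` and bounded there, by chaining, with a probability that does not depend on
`n`. Taking `R` large, for every level `M` there are an `n` and an event `A ⊆ B` of positive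
probability on which the stochastic convolution is at least `M` throughout this window.

On `A` the mild equation gives `u ≥ M` on the window. A unit interval keeps a positive fraction
`κ` of its heat up to time `1`, so if `u ≥ M` after time `s`, then `u ≥ κ δ b(M)` after time
`s + δ`. Choosing `δ` so that the bound doubles at each step costs a total time
`∑ₖ 2ᵏ⁺¹M / (κ b(2ᵏM))`, which by the Osgood condition is as small as we like for large `M`. Hence
`u` would be infinite inside the window, and `P B = 0`. Since `t₁` is arbitrary, `τ = 0` almost
surely.
-/

open Filter Topology

noncomputable section

namespace StochasticHeat

section Mixing

lemma tendsto_inner_of_pairwise_orthogonal {H : Type*} [NormedAddCommGroup H]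
    [InnerProductSpace ℝ H] {e : ℕ → H} (he : Pairwise fun i j => inner ℝ (e i) (e j) = 0) {r : ℝ}
    (hr : ∀ n, ‖e n‖ = r) (x : H) : Tendsto (fun n => inner ℝ (e n) x) atTop (𝓝 0) := by
  rcases eq_or_ne r 0 with rfl | hr0
  · simp [norm_eq_zero.1 (hr _)]
  have horth : Orthonormal ℝ fun n => r⁻¹ • e n := by
    refine ⟨fun n => ?_, fun i j hij => ?_⟩
    · rw [norm_smul, norm_inv, ← hr n, norm_norm, inv_mul_cancel₀ (by rwa [hr n])]
    · beta_reduce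
      rw [real_inner_smul_left, real_inner_smul_right, he hij, mul_zero, mul_zero]
  have hsq : Tendsto (fun n => inner ℝ (r⁻¹ • e n) x) atTop (𝓝 0) := by
    have h := (horth.inner_products_summable x).tendsto_atTop_zero.sqrt
    simp only [Real.sqrt_sq (norm_nonneg _), Real.sqrt_zero] at h
    exact tendsto_zero_iff_norm_tendsto_zero.2 h
  simpa only [real_inner_smul_left, mul_inv_cancel_left₀ hr0, mul_zero] using hsq.const_mul r

/-- By Bessel's inequality, the centred indicators of a pairwise independent sequence of events
converge weakly to zero in `L²`. -/
lemma tendsto_measureReal_inter_of_pairwise_indepSet {Ω : Type*} {mΩ : MeasurableSpace Ω}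
    {P : Measure Ω} [IsProbabilityMeasure P] {F : ℕ → Set Ω} (hF : ∀ n, MeasurableSet (F n))
    (hind : Pairwise fun i j => IndepSet (F i) (F j) P) {p : ℝ} (hp : ∀ n, P.real (F n) = p)
    {B : Set Ω} (hB : MeasurableSet B) :
    Tendsto (fun n => P.real (B ∩ F n)) atTop (𝓝 (P.real B * p)) := by
  let one {A : Set Ω} (hA : MeasurableSet A) : Lp ℝ 2 P :=
    indicatorConstLp 2 hA (measure_ne_top P A) 1
  set e : ℕ → Lp ℝ 2 P := fun n => one (hF n) - p • one MeasurableSet.univ with he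
  have inner_one {A A' : Set Ω} (hA : MeasurableSet A) (hA' : MeasurableSet A') :
      inner ℝ (one hA) (one hA') = P.real (A ∩ A') :=
    L2.real_inner_indicatorConstLp_one_indicatorConstLp_one hA hA'
  have inner_e (i j : ℕ) : inner ℝ (e i) (e j) = P.real (F i ∩ F j) - p ^ 2 := by
    simp only [he, inner_sub_left, inner_sub_right, real_inner_smul_left, real_inner_smul_right,
      inner_one, inter_univ, univ_inter, hp, probReal_univ]
    ring
  have horth : Pairwise fun i j => inner ℝ (e i) (e j) = 0 := fun i j hij => by
    beta_reduce
    rw [inner_e, measureReal_def, (hind hij).measure_inter_eq_mul, ENNReal.toReal_mul,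
      ← measureReal_def, ← measureReal_def, hp, hp, sq, sub_self]
  have hnorm (n : ℕ) : ‖e n‖ = √(p - p ^ 2) := by
    rw [norm_eq_sqrt_real_inner, inner_e, inter_self, hp]
  have hlim := tendsto_inner_of_pairwise_orthogonal horth hnorm (one hB)
  have inner_e_B (n : ℕ) : inner ℝ (e n) (one hB) + P.real B * p = P.real (B ∩ F n) := by
    rw [he, inner_sub_left, real_inner_smul_left, inner_one, inner_one, univ_inter, inter_comm]
    ring
  simpa only [inner_e_B, zero_add] using hlim.add_const (P.real B * p)

end Mixing

section Chaining

lemma norm_le_add_tsum_of_chain {T E : Type*} [SeminormedAddCommGroup E] {x : T → E}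
    {s : ℕ → Set T} {π : ℕ → T → T} (hπ : ∀ k, MapsTo (π k) (s (k + 1)) (s k)) {a : ℝ}
    {c : ℕ → ℝ} (hc : ∀ k, 0 ≤ c k) (hsum : Summable c) (hroot : ∀ t ∈ s 0, ‖x t‖ ≤ a)
    (hstep : ∀ k, ∀ t ∈ s (k + 1), ‖x t - x (π k t)‖ ≤ c k) {k : ℕ} {t : T} (ht : t ∈ s k) :
    ‖x t‖ ≤ a + ∑' i, c i := by
  have hpartial : ‖x t‖ ≤ a + ∑ i ∈ Finset.range k, c i := by
    induction k generalizing t with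
    | zero => simpa using hroot t ht
    | succ k ih =>
      calc ‖x t‖ ≤ ‖x (π k t)‖ + ‖x t - x (π k t)‖ := norm_le_insert' _ _
        _ ≤ (a + ∑ i ∈ Finset.range k, c i) + c k := add_le_add (ih (hπ k ht)) (hstep k t ht)
        _ = a + ∑ i ∈ Finset.range (k + 1), c i := by rw [Finset.sum_range_succ, add_assoc]
  have hle := hsum.sum_le_tsum (Finset.range k) fun i _ => hc i
  linarith

lemma measure_exists_lt_norm_le_of_chain {T E Ω : Type*} [SeminormedAddCommGroup E]
    {mΩ : MeasurableSpace Ω} (P : Measure Ω) (X : T → Ω → E) {s : ℕ → Finset T} {π : ℕ → T → T}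
    (hπ : ∀ k, MapsTo (π k) (s (k + 1)) (s k)) (a : ℝ) {c : ℕ → ℝ} (hc : ∀ k, 0 ≤ c k)
    (hsum : Summable c) :
    P {ω | ∃ k, ∃ t ∈ s k, a + ∑' i, c i < ‖X t ω‖} ≤
      ∑ t ∈ s 0, P {ω | a ≤ ‖X t ω‖} +
        ∑' k, ∑ t ∈ s (k + 1), P {ω | c k ≤ ‖X t ω - X (π k t) ω‖} := by
  have hsub : {ω | ∃ k, ∃ t ∈ s k, a + ∑' i, c i < ‖X t ω‖} ⊆
      (⋃ t ∈ s 0, {ω | a ≤ ‖X t ω‖}) ∪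
        ⋃ k, ⋃ t ∈ s (k + 1), {ω | c k ≤ ‖X t ω - X (π k t) ω‖} := by
    rintro ω ⟨k, t, ht, hlt⟩
    contrapose! hlt
    simp only [mem_union, mem_iUnion, mem_ofPred_eq, not_or, not_exists, not_le] at hlt
    exact norm_le_add_tsum_of_chain (x := fun t => X t ω) (s := fun k => ↑(s k)) hπ hc hsum
      (fun t ht => (hlt.1 t ht).le) (fun k t ht => (hlt.2 k t ht).le) ht
  refine (measure_mono hsub).trans ((measure_union_le _ _).trans (add_le_add ?_ ?_))
  · exact measure_biUnion_finset_le _ _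
  · exact (measure_iUnion_le _).trans (ENNReal.tsum_le_tsum fun k => measure_biUnion_finset_le _ _)

end Chaining

section UnitGrid

/-- The half-open unit square `[0, 1)²`. -/
def unitSquare : Set (ℝ × ℝ) := Ico 0 1 ×ˢ Ico 0 1

/-- The points of the unit square with coordinates in `n⁻¹ ℤ`. -/
def unitGrid (n : ℕ) : Finset (ℝ × ℝ) :=
  (Finset.range n ×ˢ Finset.range n).image fun i => (i.1 / n, i.2 / n)

/-- Rounding down to the grid of mesh `n⁻¹`. -/
def gridFloor (n : ℕ) (p : ℝ × ℝ) : ℝ × ℝ := (⌊n * p.1⌋₊ / n, ⌊n * p.2⌋₊ / n)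

lemma card_unitGrid_le (n : ℕ) : (unitGrid n).card ≤ n ^ 2 := by
  refine Finset.card_image_le.trans (le_of_eq ?_)
  rw [Finset.card_product, Finset.card_range, sq]

lemma unitGrid_one : unitGrid 1 = {0} := by
  simp [unitGrid]

lemma unitGrid_subset_unitSquare (n : ℕ) : ↑(unitGrid n) ⊆ unitSquare := by
  have hdiv {i : ℕ} (hi : i < n) : (i / n : ℝ) ∈ Ico (0 : ℝ) 1 :=
    ⟨by positivity, (div_lt_one (by exact_mod_cast i.zero_le.trans_lt hi)).2 (by exact_mod_cast hi)⟩
  intro p hp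
  obtain ⟨⟨i, j⟩, hij, rfl⟩ := Finset.mem_image.1 hp
  rw [Finset.mem_product, Finset.mem_range, Finset.mem_range] at hij
  exact ⟨hdiv hij.1, hdiv hij.2⟩

variable {n : ℕ} {p : ℝ × ℝ}

lemma gridFloor_mem_unitGrid (hn : 0 < n) (hp : p ∈ unitSquare) : gridFloor n p ∈ unitGrid n := by
  have hfloor {x : ℝ} (hx : x ∈ Ico (0 : ℝ) 1) : ⌊n * x⌋₊ < n := by
    have hn' : (0 : ℝ) < n := by exact_mod_cast hn
    rw [Nat.floor_lt (mul_nonneg hn'.le hx.1)]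
    exact mul_lt_of_lt_one_right hn' hx.2
  exact Finset.mem_image.2 ⟨(⌊n * p.1⌋₊, ⌊n * p.2⌋₊),
    by simp [hfloor hp.1, hfloor hp.2], rfl⟩

lemma abs_sub_floor_mul_div_le {x : ℝ} (hn : 0 < n) (hx : 0 ≤ x) :
    |x - ⌊n * x⌋₊ / n| ≤ (n : ℝ)⁻¹ := by
  have hn' : (0 : ℝ) < n := by exact_mod_cast hn
  have hlower : (⌊n * x⌋₊ : ℝ) / n ≤ x := by
    rw [div_le_iff₀' hn']
    exact Nat.floor_le (mul_nonneg hn'.le hx)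
  have hupper : x ≤ ⌊n * x⌋₊ / n + (n : ℝ)⁻¹ := by
    rw [← one_div, ← add_div, le_div_iff₀' hn']
    exact (Nat.lt_floor_add_one _).le
  rw [abs_le]
  constructor <;> linarith [inv_pos.2 hn']

lemma sqrt_abs_sub_gridFloor_le (hn : 0 < n) (hp : p ∈ unitSquare) :
    √|p.1 - (gridFloor n p).1| + √|p.2 - (gridFloor n p).2| ≤ 2 * √(n : ℝ)⁻¹ := by
  rw [two_mul]
  exact add_le_add (Real.sqrt_le_sqrt (abs_sub_floor_mul_div_le hn hp.1.1))
    (Real.sqrt_le_sqrt (abs_sub_floor_mul_div_le hn hp.2.1))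

end UnitGrid

section Isonormal

/-- An isonormal Gaussian process over an inner product space: a centred Gaussian family indexed
by `H` whose covariance is the inner product. The Wiener integrals of a white noise are the case
of an `L²` space. -/
structure IsIsonormal {H Ω : Type*} [NormedAddCommGroup H] [InnerProductSpace ℝ H]
    {mΩ : MeasurableSpace Ω} (W : H → Ω → ℝ) (P : Measure Ω) : Prop where
  measurable : ∀ φ, Measurable (W φ)
  gaussian : IsGaussianProcess W P
  centered : ∀ φ, ∫ ω, W φ ω ∂P = 0
  covariance : ∀ φ ψ, ∫ ω, W φ ω * W ψ ω ∂P = inner ℝ φ ψ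

namespace IsIsonormal

variable {H Ω : Type*} [NormedAddCommGroup H] [InnerProductSpace ℝ H] {mΩ : MeasurableSpace Ω}
  {P : Measure Ω} {W : H → Ω → ℝ}

lemma memLp (hW : IsIsonormal W P) (φ : H) : MemLp (W φ) 2 P :=
  (hW.gaussian.hasGaussianLaw_eval φ).memLp_two

lemma inner_toLp (hW : IsIsonormal W P) (φ ψ : H) :
    inner ℝ ((hW.memLp φ).toLp (W φ)) ((hW.memLp ψ).toLp (W ψ)) = inner ℝ φ ψ := by
  rw [L2.inner_def, ← hW.covariance]
  refine integral_congr_ae ?_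
  filter_upwards [(hW.memLp φ).coeFn_toLp, (hW.memLp ψ).coeFn_toLp] with ω h1 h2
  rw [h1, h2]
  simp [mul_comm]

lemma add_smul_ae (hW : IsIsonormal W P) (φ ψ : H) (c : ℝ) :
    W (φ + c • ψ) =ᵐ[P] fun ω => W φ ω + c * W ψ ω := by
  have h : (hW.memLp (φ + c • ψ)).toLp (W (φ + c • ψ))
      = (hW.memLp φ).toLp (W φ) + c • (hW.memLp ψ).toLp (W ψ) := by
    rw [← sub_eq_zero, ← inner_self_eq_zero (𝕜 := ℝ)]
    simp only [inner_sub_left, inner_sub_right, inner_add_left, inner_add_right,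
      inner_smul_left, inner_smul_right, hW.inner_toLp]
    ring
  filter_upwards [(hW.memLp (φ + c • ψ)).coeFn_toLp, (hW.memLp φ).coeFn_toLp,
    (hW.memLp ψ).coeFn_toLp, Lp.coeFn_add ((hW.memLp φ).toLp (W φ)) (c • (hW.memLp ψ).toLp (W ψ)),
    Lp.coeFn_smul c ((hW.memLp ψ).toLp (W ψ))] with ω h1 h2 h3 h4 h5
  rw [← h1, h, h4, Pi.add_apply, h5, Pi.smul_apply, h2, h3, smul_eq_mul]

lemma sub_ae (hW : IsIsonormal W P) (φ ψ : H) :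
    W (φ - ψ) =ᵐ[P] fun ω => W φ ω - W ψ ω := by
  have h := hW.add_smul_ae φ ψ (-1)
  rw [neg_one_smul, ← sub_eq_add_neg] at h
  filter_upwards [h] with ω hω
  rw [hω]
  ring

lemma ae_eq_projection_add (hW : IsIsonormal W P) (e φ : H) :
    W φ =ᵐ[P] fun ω =>
      W ((ℝ ∙ e)ᗮ.starProjection φ) ω + inner ℝ e φ / ‖e‖ ^ 2 * W e ω := by
  have hφ : φ = (ℝ ∙ e)ᗮ.starProjection φ + (inner ℝ e φ / ‖e‖ ^ 2) • e := by
    rw [Submodule.starProjection_orthogonal_val, Submodule.starProjection_singleton]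
    simp
  nth_rw 1 [hφ]
  exact hW.add_smul_ae _ _ _

lemma eLpNorm_eq (hW : IsIsonormal W P) (φ : H) : eLpNorm (W φ) 2 P = ENNReal.ofReal ‖φ‖ := by
  rw [norm_eq_sqrt_real_inner φ, ← hW.inner_toLp, ← norm_eq_sqrt_real_inner, Lp.norm_toLp,
    ENNReal.ofReal_toReal (hW.memLp φ).2.ne]

lemma ae_le_of_tendsto (hW : IsIsonormal W P) {φ : ℕ → H} {ψ : H} (h : Tendsto φ atTop (𝓝 ψ))
    (m : ℝ) : ∀ᵐ ω ∂P, (∀ k, m ≤ W (φ k) ω) → m ≤ W ψ ω := by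
  have hL2 : Tendsto (fun k => eLpNorm (W (φ k) - W ψ) 2 P) atTop (𝓝 0) := by
    have heq (k : ℕ) : eLpNorm (W (φ k) - W ψ) 2 P = ENNReal.ofReal ‖φ k - ψ‖ := by
      rw [← hW.eLpNorm_eq, eLpNorm_congr_ae (hW.sub_ae _ _)]
      rfl
    simpa only [heq, ENNReal.ofReal_zero] using
      ENNReal.tendsto_ofReal (tendsto_iff_norm_sub_tendsto_zero.1 h)
  obtain ⟨n, -, hn⟩ := (tendstoInMeasure_of_tendsto_eLpNorm two_ne_zero
    (fun k => (hW.measurable _).aestronglyMeasurable) (hW.measurable ψ).aestronglyMeasurable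
    hL2).exists_seq_tendsto_ae
  filter_upwards [hn] with ω hω hle
  exact ge_of_tendsto' hω fun i => hle (n i)

variable [IsProbabilityMeasure P]

lemma cov_eq (hW : IsIsonormal W P) (φ ψ : H) : cov[W φ, W ψ; P] = inner ℝ φ ψ := by
  rw [covariance_eq_sub (hW.memLp φ) (hW.memLp ψ), hW.centered, zero_mul, sub_zero]
  exact hW.covariance φ ψ

lemma map_eq (hW : IsIsonormal W P) (φ : H) :
    P.map (W φ) = gaussianReal 0 (‖φ‖ ^ 2).toNNReal := by
  rw [(hW.gaussian.hasGaussianLaw_eval φ).map_eq_gaussianReal, hW.centered,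
    ← covariance_self (hW.measurable φ).aemeasurable, hW.cov_eq, real_inner_self_eq_norm_sq]

lemma hasSubgaussianMGF (hW : IsIsonormal W P) (φ : H) {c : ℝ≥0} (hc : ‖φ‖ ^ 2 ≤ c) :
    HasSubgaussianMGF (W φ) c P where
  integrable_exp_mul t := by
    have h := integrable_exp_mul_gaussianReal (μ := 0) (v := (‖φ‖ ^ 2).toNNReal) t
    rw [← hW.map_eq, integrable_map_measure (by fun_prop) (hW.measurable φ).aemeasurable] at h
    exact h
  mgf_le t := by
    rw [mgf_gaussianReal (hW.map_eq φ), Real.coe_toNNReal _ (sq_nonneg _), zero_mul, zero_add]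
    gcongr

lemma measure_le_abs_le (hW : IsIsonormal W P) (m : ℕ) {φ : H} {c a : ℝ} (hc : 0 < c)
    (hφ : ‖φ‖ ^ 2 ≤ c) (ha : 0 < a) :
    P {ω | a ≤ |W φ ω|} ≤ ENNReal.ofReal (2 * m.factorial * (2 * c / a ^ 2) ^ m) := by
  have htail : HasSubgaussianMGF (W φ) ⟨c, hc.le⟩ P := hW.hasSubgaussianMGF φ hφ
  have hexp : Real.exp (-a ^ 2 / (2 * c)) ≤ m.factorial * (2 * c / a ^ 2) ^ m := by
    have h := Real.pow_div_factorial_le_exp (x := a ^ 2 / (2 * c)) (by positivity) m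
    rw [neg_div, Real.exp_neg, inv_le_comm₀ (Real.exp_pos _) (by positivity)]
    refine le_trans (le_of_eq ?_) h
    rw [mul_inv, ← inv_pow, inv_div, inv_mul_eq_div]
  have hsub : {ω | a ≤ |W φ ω|} ⊆ {ω | a ≤ W φ ω} ∪ {ω | a ≤ (-W φ) ω} := by
    intro ω hω
    exact le_abs.1 (show a ≤ |W φ ω| from hω)
  rw [← ofReal_measureReal]
  refine ENNReal.ofReal_le_ofReal ?_
  calc P.real {ω | a ≤ |W φ ω|} ≤ P.real ({ω | a ≤ W φ ω} ∪ {ω | a ≤ (-W φ) ω}) :=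
        measureReal_mono hsub
    _ ≤ P.real {ω | a ≤ W φ ω} + P.real {ω | a ≤ (-W φ) ω} := measureReal_union_le _ _
    _ ≤ Real.exp (-a ^ 2 / (2 * c)) + Real.exp (-a ^ 2 / (2 * c)) :=
        add_le_add (htail.measure_ge_le ha.le) (htail.neg.measure_ge_le ha.le)
    _ ≤ 2 * m.factorial * (2 * c / a ^ 2) ^ m := by linarith

lemma measure_le_abs_sub_le (hW : IsIsonormal W P) (m : ℕ) {φ ψ : H} {c a : ℝ} (hc : 0 < c)
    (hφ : ‖φ - ψ‖ ^ 2 ≤ c) (ha : 0 < a) :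
    P {ω | a ≤ |W φ ω - W ψ ω|} ≤ ENNReal.ofReal (2 * m.factorial * (2 * c / a ^ 2) ^ m) := by
  refine le_trans (measure_mono_ae ?_) (hW.measure_le_abs_le m hc hφ ha)
  filter_upwards [hW.sub_ae φ ψ] with ω hω h
  change a ≤ |W (φ - ψ) ω|
  rwa [hω]

lemma indepFun (hW : IsIsonormal W P) {S T : Type*} (f : S → H) (g : T → H)
    (h : ∀ s t, inner ℝ (f s) (g t) = 0) :
    IndepFun (fun ω s => W (f s) ω) (fun ω t => W (g t) ω) P := by
  refine IsGaussianProcess.indepFun_of_covariance_eq_zero (X := fun s => W (f s))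
    (Y := fun t => W (g t)) ?_ (fun s => (hW.measurable _).aemeasurable)
    (fun t => (hW.measurable _).aemeasurable) fun s t => by rw [hW.cov_eq, h]
  have hXY : Sum.elim (fun s => W (f s)) (fun t => W (g t)) = W ∘ Sum.elim f g := by
    funext p
    cases p <;> rfl
  rw [hXY]
  exact hW.gaussian.comp_right _

lemma pairwise_indepSet_le (hW : IsIsonormal W P) {ι : Type*} {e : ι → H}
    (he : Pairwise fun i j => inner ℝ (e i) (e j) = 0) (a : ℝ) :
    Pairwise fun i j => IndepSet {ω | a ≤ W (e i) ω} {ω | a ≤ W (e j) ω} P := by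
  intro i j hij
  have h := hW.indepFun (fun _ : Unit => e i) (fun _ : Unit => e j) fun _ _ => he hij
  have hmeas : MeasurableSet {f : Unit → ℝ | a ≤ f ()} :=
    measurableSet_le measurable_const (measurable_pi_apply ())
  exact (indepFun_iff_indepSet_preimage (measurable_pi_lambda _ fun _ => hW.measurable _)
    (measurable_pi_lambda _ fun _ => hW.measurable _)).1 h _ _ hmeas hmeas

lemma measure_le_eq_of_norm_eq (hW : IsIsonormal W P) {φ ψ : H} (h : ‖φ‖ = ‖ψ‖) (a : ℝ) :
    P {ω | a ≤ W φ ω} = P {ω | a ≤ W ψ ω} := by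
  change P (W φ ⁻¹' Ici a) = P (W ψ ⁻¹' Ici a)
  rw [← Measure.map_apply (hW.measurable φ) measurableSet_Ici, hW.map_eq, h, ← hW.map_eq,
    Measure.map_apply (hW.measurable ψ) measurableSet_Ici]

lemma measure_le_pos (hW : IsIsonormal W P) {φ : H} (hφ : φ ≠ 0) (a : ℝ) :
    0 < P {ω | a ≤ W φ ω} := by
  have hv : (‖φ‖ ^ 2).toNNReal ≠ 0 := (Real.toNNReal_pos.2 (by positivity)).ne'
  change 0 < P (W φ ⁻¹' Ici a)
  rw [← Measure.map_apply (hW.measurable φ) measurableSet_Ici, hW.map_eq, pos_iff_ne_zero]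
  intro h
  simpa using gaussianReal_absolutelyContinuous' 0 hv h

end IsIsonormal

end Isonormal

section HolderField

variable {H : Type*} [NormedAddCommGroup H]

/-- Hölder continuity of order `1/4` on the unit square, with the constant on the squared norm:
this is the parabolic regularity of the stochastic convolution, read off in `L²`. -/
def IsQuarterHolder (C : ℝ) (g : ℝ × ℝ → H) : Prop :=
  ∀ p ∈ unitSquare, ∀ q ∈ unitSquare,
    ‖g p - g q‖ ^ 2 ≤ C * (√|p.1 - q.1| + √|p.2 - q.2|)

variable {C : ℝ} {g : ℝ × ℝ → H} {p : ℝ × ℝ}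

lemma IsQuarterHolder.norm_sub_gridFloor_sq_le (hC : 0 ≤ C) (hg : IsQuarterHolder C g)
    (hp : p ∈ unitSquare) (k : ℕ) :
    ‖g p - g (gridFloor (4 ^ k) p)‖ ^ 2 ≤ 2 * C * (1 / 2) ^ k := by
  have hpos : 0 < 4 ^ k := by positivity
  have hsqrt : √((4 ^ k : ℕ) : ℝ)⁻¹ = (1 / 2) ^ k := by
    rw [Real.sqrt_eq_iff_mul_self_eq_of_pos (by positivity), ← mul_pow,
      Nat.cast_pow, ← inv_pow]
    congr 1
    norm_num
  have hle := (hg p hp _ (unitGrid_subset_unitSquare _ (gridFloor_mem_unitGrid hpos hp))).trans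
    (mul_le_mul_of_nonneg_left (sqrt_abs_sub_gridFloor_le hpos hp) hC)
  rw [hsqrt] at hle
  linarith

lemma IsQuarterHolder.tendsto_gridFloor (hC : 0 ≤ C) (hg : IsQuarterHolder C g)
    (hp : p ∈ unitSquare) : Tendsto (fun k => g (gridFloor (4 ^ k) p)) atTop (𝓝 (g p)) := by
  have hsq : Tendsto (fun k => ‖g (gridFloor (4 ^ k) p) - g p‖ ^ 2) atTop (𝓝 0) := by
    have hgeom : Tendsto (fun k : ℕ => 2 * C * (1 / 2 : ℝ) ^ k) atTop (𝓝 0) := by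
      simpa using (tendsto_pow_atTop_nhds_zero_of_lt_one (r := (1 / 2 : ℝ)) (by norm_num)
        (by norm_num)).const_mul (2 * C)
    refine squeeze_zero (fun k => sq_nonneg _) (fun k => ?_) hgeom
    rw [norm_sub_rev]
    exact hg.norm_sub_gridFloor_sq_le hC hp k
  have h := hsq.sqrt
  simp only [Real.sqrt_sq (norm_nonneg _), Real.sqrt_zero] at h
  exact tendsto_iff_norm_sub_tendsto_zero.2 h

lemma IsQuarterHolder.comp_of_norm_sub_le {H' : Type*} [NormedAddCommGroup H'] {f : ℝ × ℝ → H'}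
    (hg : IsQuarterHolder C g) (hf : ∀ p q, ‖f p - f q‖ ≤ ‖g p - g q‖) : IsQuarterHolder C f :=
  fun p hp q hq => (pow_le_pow_left₀ (norm_nonneg _) (hf p q) 2).trans (hg p hp q hq)

end HolderField

/-- The functions that exceed `K` in absolute value at some point of the nested grids of mesh
`4⁻ᵏ`. The mesh is chosen so that an increment of order `1/4` over it is of size `2^(-k/2)`. -/
def gridExceedance (K : ℝ) : Set (ℝ × ℝ → ℝ) := {f | ∃ k, ∃ p ∈ unitGrid (4 ^ k), K < |f p|}

lemma measurableSet_gridExceedance (K : ℝ) : MeasurableSet (gridExceedance K) := by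
  have heq : gridExceedance K = ⋃ k, ⋃ p ∈ unitGrid (4 ^ k), {f | K < |f p|} := by
    ext f
    simp [gridExceedance]
  rw [heq]
  exact .iUnion fun k => Finset.measurableSet_biUnion _ fun p _ =>
    measurableSet_lt measurable_const (by fun_prop)

namespace IsIsonormal

variable {H Ω : Type*} [NormedAddCommGroup H] [InnerProductSpace ℝ H] {mΩ : MeasurableSpace Ω}
  {P : Measure Ω} [IsProbabilityMeasure P] {W : H → Ω → ℝ} {C : ℝ} {g : ℝ × ℝ → H}

/-- The thresholds `κ (9/10)^k` are summable, and with the eighth-order tail bound the `16^(k+1)`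
increments of variance `2^(-k)` still have geometrically small total probability. -/
lemma sum_measure_increment_le (hW : IsIsonormal W P) (hC : 0 < C) {κ : ℝ} (hκ : 0 < κ)
    (hg : IsQuarterHolder C g) (k : ℕ) :
    ∑ p ∈ unitGrid (4 ^ (k + 1)),
        P {ω | κ * (9 / 10) ^ k ≤ ‖W (g p) ω - W (g (gridFloor (4 ^ k) p)) ω‖} ≤
      ENNReal.ofReal (32 * Nat.factorial 8 * (4 * C / κ ^ 2) ^ 8 * (1 / 2) ^ k) := by
  have hincr (p) (hp : p ∈ unitGrid (4 ^ (k + 1))) :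
      P {ω | κ * (9 / 10) ^ k ≤ ‖W (g p) ω - W (g (gridFloor (4 ^ k) p)) ω‖} ≤
        ENNReal.ofReal (2 * Nat.factorial 8 *
          (2 * (2 * C * (1 / 2) ^ k) / (κ * (9 / 10) ^ k) ^ 2) ^ 8) :=
    hW.measure_le_abs_sub_le 8 (by positivity)
      (hg.norm_sub_gridFloor_sq_le hC.le (unitGrid_subset_unitSquare _ hp) k) (by positivity)
  have hcard : ((unitGrid (4 ^ (k + 1))).card : ℝ) ≤ 16 * 16 ^ k := by
    refine (Nat.cast_le.2 (card_unitGrid_le _)).trans (le_of_eq ?_)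
    push_cast
    rw [pow_right_comm, pow_succ']
    norm_num
  have hratio : (16 * ((1 / 2) ^ 8 / (9 / 10) ^ 16) : ℝ) ^ k ≤ (1 / 2) ^ k :=
    pow_le_pow_left₀ (by positivity) (by norm_num) k
  refine (Finset.sum_le_card_nsmul _ _ _ hincr).trans ?_
  rw [nsmul_eq_mul, ← ENNReal.ofReal_natCast, ← ENNReal.ofReal_mul (Nat.cast_nonneg _)]
  refine ENNReal.ofReal_le_ofReal ?_
  calc _ ≤ 16 * 16 ^ k * (2 * Nat.factorial 8 *
          (2 * (2 * C * (1 / 2) ^ k) / (κ * (9 / 10) ^ k) ^ 2) ^ 8) := by gcongr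
    _ = 32 * Nat.factorial 8 * (4 * C / κ ^ 2) ^ 8 *
          (16 * ((1 / 2) ^ 8 / (9 / 10) ^ 16)) ^ k := by
        simp only [mul_pow, div_pow, ← pow_mul, one_pow]
        field_simp
        ring
    _ ≤ _ := by gcongr

lemma measure_gridExceedance_le (hW : IsIsonormal W P) (hC : 0 < C) {κ : ℝ} (hκ : 0 < κ)
    (h0 : ‖g 0‖ ^ 2 ≤ C) (hg : IsQuarterHolder C g) :
    P ((fun ω p => W (g p) ω) ⁻¹' gridExceedance (11 * κ)) ≤
      ENNReal.ofReal (96 * Nat.factorial 8 * (4 * C / κ ^ 2) ^ 8) := by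
  set D : ℝ := 32 * Nat.factorial 8 * (4 * C / κ ^ 2) ^ 8 with hD
  have hgeom : ∑' k : ℕ, κ * (9 / 10 : ℝ) ^ k = 10 * κ := by
    rw [tsum_mul_left, tsum_geometric_of_lt_one (by norm_num) (by norm_num)]
    ring
  have hchain := measure_exists_lt_norm_le_of_chain P (fun p => W (g p))
    (s := fun k => unitGrid (4 ^ k)) (π := fun k => gridFloor (4 ^ k))
    (fun k p hp => gridFloor_mem_unitGrid (by positivity) (unitGrid_subset_unitSquare _ hp)) κ
    (c := fun k => κ * (9 / 10) ^ k) (fun k => by positivity)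
    ((summable_geometric_of_lt_one (by norm_num) (by norm_num)).mul_left κ)
  rw [hgeom, show κ + 10 * κ = 11 * κ by ring] at hchain
  have hroot : ∑ p ∈ unitGrid (4 ^ 0), P {ω | κ ≤ ‖W (g p) ω‖} ≤ ENNReal.ofReal D := by
    rw [pow_zero, unitGrid_one, Finset.sum_singleton]
    refine (hW.measure_le_abs_le 8 hC h0 hκ).trans (ENNReal.ofReal_le_ofReal ?_)
    rw [hD]
    gcongr <;> norm_num
  have hsteps : ∑' k, ∑ p ∈ unitGrid (4 ^ (k + 1)),
      P {ω | κ * (9 / 10) ^ k ≤ ‖W (g p) ω - W (g (gridFloor (4 ^ k) p)) ω‖} ≤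
        ENNReal.ofReal (2 * D) := by
    refine (ENNReal.tsum_le_tsum fun k => hW.sum_measure_increment_le hC hκ hg k).trans ?_
    have hsum : Summable fun k : ℕ => D * (1 / 2) ^ k := summable_geometric_two.mul_left D
    rw [← ENNReal.ofReal_tsum_of_nonneg (fun k => by positivity) hsum, tsum_mul_left,
      tsum_geometric_two, mul_comm]
  refine (hchain.trans (add_le_add hroot hsteps)).trans (le_of_eq ?_)
  rw [← ENNReal.ofReal_add (by positivity) (by positivity), hD]
  ring_nf

lemma exists_forall_measure_gridExceedance_le (hW : IsIsonormal W P) (hC : 0 < C) {θ : ℝ}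
    (hθ : 0 < θ) :
    ∃ K, ∀ g : ℝ × ℝ → H, ‖g 0‖ ^ 2 ≤ C → IsQuarterHolder C g →
      P ((fun ω p => W (g p) ω) ⁻¹' gridExceedance K) ≤ ENNReal.ofReal θ := by
  have hlim : Tendsto (fun κ : ℝ => 96 * Nat.factorial 8 * (4 * C / κ ^ 2) ^ 8) atTop (𝓝 0) := by
    have h : Tendsto (fun κ : ℝ => 4 * C / κ ^ 2) atTop (𝓝 0) :=
      tendsto_const_nhds.div_atTop (tendsto_pow_atTop two_ne_zero)
    simpa using (h.pow 8).const_mul (96 * (Nat.factorial 8 : ℝ))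
  obtain ⟨κ, hκ, hκ0⟩ := ((hlim.eventually_le_const hθ).and (eventually_gt_atTop 0)).exists
  exact ⟨11 * κ, fun g h0 hg => (hW.measure_gridExceedance_le hC hκ0 h0 hg).trans
    (ENNReal.ofReal_le_ofReal hκ)⟩

end IsIsonormal

lemma exists_measure_inter_diff_ne_zero {Ω : Type*} {mΩ : MeasurableSpace Ω} {P : Measure Ω}
    [IsProbabilityMeasure P] {F N : ℕ → Set Ω} (hF : ∀ n, MeasurableSet (F n))
    (hind : Pairwise fun i j => IndepSet (F i) (F j) P) {p θ : ℝ} (hp : ∀ n, P.real (F n) = p)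
    (hp0 : 0 < p) (hFN : ∀ n, P.real (F n ∩ N n) ≤ p * θ) {B : Set Ω} (hB : MeasurableSet B)
    (hθ : θ < P.real B) : ∃ n, P (B ∩ (F n \ N n)) ≠ 0 := by
  by_contra! hnull
  have hle (n : ℕ) : P.real (B ∩ F n) ≤ p * θ := by
    have hsub : B ∩ F n ⊆ B ∩ (F n \ N n) ∪ F n ∩ N n := by
      rw [← inter_sdiff_assoc]
      exact fun ω hω => (em (ω ∈ N n)).elim (fun h => .inr ⟨hω.2, h⟩) fun h => .inl ⟨hω, h⟩
    calc P.real (B ∩ F n) ≤ P.real (B ∩ (F n \ N n)) + P.real (F n ∩ N n) :=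
          (measureReal_mono hsub).trans (measureReal_union_le _ _)
      _ ≤ p * θ := by rw [measureReal_def, hnull n, ENNReal.toReal_zero, zero_add]; exact hFN n
  have hlim := le_of_tendsto' (tendsto_measureReal_inter_of_pairwise_indepSet hF hind hp hB) hle
  rw [mul_comm] at hlim
  exact hθ.not_ge (le_of_mul_le_mul_left hlim hp0)

namespace IsIsonormal

variable {H Ω : Type*} [NormedAddCommGroup H] [InnerProductSpace ℝ H] {mΩ : MeasurableSpace Ω}
  {P : Measure Ω} {W : H → Ω → ℝ} {C : ℝ} {g : ℝ × ℝ → H}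

/-- Removing from `g` its component along `e` makes the grid maximum independent of `W e`. -/
lemma measure_inter_gridExceedance [IsProbabilityMeasure P] (hW : IsIsonormal W P) (e : H)
    (g : ℝ × ℝ → H) (R K : ℝ) :
    P ({ω | R ≤ W e ω} ∩
        (fun ω p => W ((ℝ ∙ e)ᗮ.starProjection (g p)) ω) ⁻¹' gridExceedance K) =
      P {ω | R ≤ W e ω} *
        P ((fun ω p => W ((ℝ ∙ e)ᗮ.starProjection (g p)) ω) ⁻¹' gridExceedance K) := by
  have hind := hW.indepFun (fun _ : Unit => e) (fun p => (ℝ ∙ e)ᗮ.starProjection (g p))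
    fun _ p => Submodule.mem_orthogonal_singleton_iff_inner_right.1
      (Submodule.starProjection_apply_mem _ _)
  have hR : MeasurableSet {f : Unit → ℝ | R ≤ f ()} :=
    measurableSet_le measurable_const (measurable_pi_apply ())
  exact hind.measure_inter_preimage_eq_mul _ _ hR (measurableSet_gridExceedance K)

lemma exists_forall_measure_projection_gridExceedance_le [IsProbabilityMeasure P]
    (hW : IsIsonormal W P) (hC : 0 < C) {θ : ℝ} (hθ : 0 < θ) :
    ∃ K, ∀ (e : H) (g : ℝ × ℝ → H), ‖g 0‖ ^ 2 ≤ C → IsQuarterHolder C g →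
      P ((fun ω p => W ((ℝ ∙ e)ᗮ.starProjection (g p)) ω) ⁻¹' gridExceedance K) ≤
        ENNReal.ofReal θ := by
  obtain ⟨K, hK⟩ := hW.exists_forall_measure_gridExceedance_le hC hθ
  have hcontr (e φ : H) : ‖(ℝ ∙ e)ᗮ.starProjection φ‖ ≤ ‖φ‖ :=
    Submodule.norm_starProjection_apply_le _ φ
  refine ⟨K, fun e g h0 hg => hK _ ?_ ?_⟩
  · exact (pow_le_pow_left₀ (norm_nonneg _) (hcontr e _) 2).trans h0
  · exact hg.comp_of_norm_sub_le fun p q => by rw [← map_sub]; exact hcontr e _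

lemma ae_le_of_le_of_notMem_gridExceedance (hW : IsIsonormal W P) (hC : 0 ≤ C)
    (hg : IsQuarterHolder C g) {e : H} {c R K : ℝ} (hc : 0 ≤ c) (hR : 0 ≤ R)
    (hinner : ∀ p ∈ unitSquare, c ≤ inner ℝ e (g p)) {p : ℝ × ℝ} (hp : p ∈ unitSquare) :
    ∀ᵐ ω ∂P, R ≤ W e ω →
      (fun p => W ((ℝ ∙ e)ᗮ.starProjection (g p)) ω) ∉ gridExceedance K →
      c / ‖e‖ ^ 2 * R - K ≤ W (g p) ω := by
  filter_upwards [hW.ae_le_of_tendsto (hg.tendsto_gridFloor hC hp) (c / ‖e‖ ^ 2 * R - K),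
    ae_all_iff.2 fun k => hW.ae_eq_projection_add e (g (gridFloor (4 ^ k) p))]
    with ω hlim hproj hRω hK
  refine hlim fun k => ?_
  have hmem : gridFloor (4 ^ k) p ∈ unitGrid (4 ^ k) := gridFloor_mem_unitGrid (by positivity) hp
  have hrest : |W ((ℝ ∙ e)ᗮ.starProjection (g (gridFloor (4 ^ k) p))) ω| ≤ K :=
    not_lt.1 fun h => hK ⟨k, _, hmem, h⟩
  have hmain : c / ‖e‖ ^ 2 * R ≤ inner ℝ e (g (gridFloor (4 ^ k) p)) / ‖e‖ ^ 2 * W e ω := by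
    have hle := hinner _ (unitGrid_subset_unitSquare _ hmem)
    have hpos := hc.trans hle
    gcongr
  rw [hproj k]
  linarith [(abs_le.1 hrest).1]

/-- As `n → ∞` the event `R ≤ W (e n)` becomes independent of `B`, whereas the component of `g n`
orthogonal to `e n` is independent of it and is bounded with probability as close to one as
needed. -/
theorem exists_event_forall_ae_le [IsProbabilityMeasure P] (hW : IsIsonormal W P) (hC : 0 < C)
    {e : ℕ → H} (he : Pairwise fun i j => inner ℝ (e i) (e j) = 0) {r : ℝ} (hr : 0 < r)
    (hnorm : ∀ n, ‖e n‖ = r) {g : ℕ → ℝ × ℝ → H} (hg0 : ∀ n, ‖g n 0‖ ^ 2 ≤ C)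
    (hg : ∀ n, IsQuarterHolder C (g n)) {c : ℝ} (hc : 0 < c)
    (hinner : ∀ n, ∀ p ∈ unitSquare, c ≤ inner ℝ (e n) (g n p)) (m : ℝ) {B : Set Ω}
    (hB : MeasurableSet B) (hPB : P B ≠ 0) :
    ∃ n, ∃ A ⊆ B, MeasurableSet A ∧ P A ≠ 0 ∧
      ∀ p ∈ unitSquare, ∀ᵐ ω ∂P, ω ∈ A → m ≤ W (g n p) ω := by
  have hB0 : 0 < P.real B := ENNReal.toReal_pos hPB (measure_ne_top _ _)
  obtain ⟨K, hK⟩ := hW.exists_forall_measure_projection_gridExceedance_le hC (half_pos hB0)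
  obtain ⟨R, hR0, hR⟩ : ∃ R, 0 ≤ R ∧ m ≤ c / r ^ 2 * R - K := by
    refine ⟨r ^ 2 / c * |m + K|, by positivity, ?_⟩
    rw [← mul_assoc, div_mul_div_cancel₀ (by positivity), div_self hc.ne', one_mul]
    linarith [le_abs_self (m + K)]
  set F : ℕ → Set Ω := fun n => {ω | R ≤ W (e n) ω}
  set N : ℕ → Set Ω := fun n =>
    (fun ω p => W ((ℝ ∙ e n)ᗮ.starProjection (g n p)) ω) ⁻¹' gridExceedance K
  have hFmeas (n : ℕ) : MeasurableSet (F n) := measurableSet_le measurable_const (hW.measurable _)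
  have hNmeas (n : ℕ) : MeasurableSet (N n) :=
    measurable_pi_lambda _ (fun p => hW.measurable _) (measurableSet_gridExceedance K)
  have hFp (n : ℕ) : P (F n) = P (F 0) :=
    hW.measure_le_eq_of_norm_eq ((hnorm n).trans (hnorm 0).symm) R
  have hF0 : 0 < P.real (F 0) := ENNReal.toReal_pos
    (hW.measure_le_pos (norm_pos_iff.1 (hr.trans_eq (hnorm 0).symm)) R).ne' (measure_ne_top _ _)
  have hFN (n : ℕ) : P.real (F n ∩ N n) ≤ P.real (F 0) * (P.real B / 2) := by
    rw [measureReal_def, hW.measure_inter_gridExceedance, ENNReal.toReal_mul, hFp n]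
    exact mul_le_mul_of_nonneg_left (ENNReal.toReal_le_of_le_ofReal (by positivity)
      (hK (e n) (g n) (hg0 n) (hg n))) hF0.le
  obtain ⟨n, hn⟩ := exists_measure_inter_diff_ne_zero hFmeas (hW.pairwise_indepSet_le he R)
    (fun n => congrArg ENNReal.toReal (hFp n)) hF0 hFN hB (half_lt_self hB0)
  refine ⟨n, B ∩ (F n \ N n), inter_subset_left, hB.inter ((hFmeas n).diff (hNmeas n)), hn,
    fun p hp => ?_⟩
  filter_upwards [hW.ae_le_of_le_of_notMem_gridExceedance hC.le (hg n) hc.le hR0 (hinner n) hp]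
    with ω hω hA
  rw [hnorm] at hω
  exact hR.trans (hω hA.2.1 hA.2.2)

end IsIsonormal

section HeatKernel

lemma heatKernel_nonneg (t x y : ℝ) : 0 ≤ heatKernel t x y := by
  unfold heatKernel
  positivity

lemma heatKernel_self (t x : ℝ) : heatKernel t x x = (√(4 * Real.pi * t))⁻¹ := by
  simp [heatKernel]

lemma heatKernel_self_eq_rpow {t : ℝ} (ht : 0 < t) (x : ℝ) :
    heatKernel t x x = (√(4 * Real.pi))⁻¹ * t ^ (-(1 / 2) : ℝ) := by
  rw [heatKernel_self, Real.sqrt_mul (by positivity), mul_inv, Real.rpow_neg ht.le,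
    ← Real.sqrt_eq_rpow]

lemma heatKernel_eq_self_mul_exp (t x y : ℝ) :
    heatKernel t x y = heatKernel t x x * Real.exp (-((x - y) ^ 2 / (4 * t))) := by
  rw [heatKernel_self, heatKernel, neg_div]

lemma le_heatKernel {s t v d x y : ℝ} (hs : 0 < s) (hsv : s ≤ v) (hvt : v ≤ t)
    (hxy : |x - y| ≤ d) :
    (√(4 * Real.pi * t))⁻¹ * Real.exp (-(d ^ 2 / (4 * s))) ≤ heatKernel v x y := by
  have hv : 0 < v := hs.trans_le hsv
  rw [heatKernel_eq_self_mul_exp, heatKernel_self, ← sq_abs (x - y)]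
  gcongr

lemma integral_heatKernel_mul_heatKernel {s t : ℝ} (hs : 0 < s) (ht : 0 < t) (x y : ℝ) :
    ∫ z, heatKernel s x z * heatKernel t y z = heatKernel (s + t) x y := by
  have complete_square : ∀ z, heatKernel s x z * heatKernel t y z
      = (√(4 * Real.pi * s))⁻¹ * (√(4 * Real.pi * t))⁻¹ *
        Real.exp (-(x - y) ^ 2 / (4 * (s + t))) *
        Real.exp (-((s + t) / (4 * s * t)) * (z - (t * x + s * y) / (s + t)) ^ 2) := by
    intro z
    rw [mul_assoc _ (Real.exp _), ← Real.exp_add]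
    unfold heatKernel
    rw [mul_mul_mul_comm, ← Real.exp_add]
    congr 2
    field_simp
    ring
  have hvar : Real.pi / ((s + t) / (4 * s * t))
      = (4 * Real.pi * s) * (4 * Real.pi * t) / (4 * Real.pi * (s + t)) := by
    field_simp
  have hs' : √(4 * Real.pi * s) ≠ 0 := by positivity
  have ht' : √(4 * Real.pi * t) ≠ 0 := by positivity
  simp_rw [complete_square]
  rw [integral_const_mul, integral_sub_right_eq_self
      (fun z => Real.exp (-((s + t) / (4 * s * t)) * z ^ 2)), integral_gaussian, hvar,
    Real.sqrt_div (by positivity), Real.sqrt_mul (show 0 ≤ 4 * Real.pi * s by positivity),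
    heatKernel]
  field_simp

lemma integral_heatKernel_self {a s : ℝ} (hs : 0 ≤ s) (has : 2 * s ≤ a) (x : ℝ) :
    ∫ r in Ioo 0 s, heatKernel (a - 2 * r) x x = (√(4 * Real.pi))⁻¹ * (√a - √(a - 2 * s)) := by
  have hpow : ∫ r in Ioo 0 s, heatKernel (a - 2 * r) x x
      = ∫ r in Ioo 0 s, (√(4 * Real.pi))⁻¹ * (a - 2 * r) ^ (-(1 / 2) : ℝ) :=
    setIntegral_congr_fun measurableSet_Ioo fun r hr =>
      heatKernel_self_eq_rpow (by linarith [hr.2]) x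
  rw [hpow, integral_const_mul, ← integral_Ioc_eq_integral_Ioo,
    ← intervalIntegral.integral_of_le hs,
    intervalIntegral.integral_comp_sub_mul (fun v => v ^ (-(1 / 2) : ℝ)) two_ne_zero,
    integral_rpow (Or.inl (by norm_num)), show (-(1 / 2) + 1 : ℝ) = 1 / 2 by norm_num,
    ← Real.sqrt_eq_rpow, ← Real.sqrt_eq_rpow, smul_eq_mul, mul_zero, sub_zero]
  ring

lemma inv_sqrt_four_pi_le_half : (√(4 * Real.pi))⁻¹ ≤ 1 / 2 := by
  rw [inv_le_comm₀ (by positivity) (by norm_num)]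
  refine Real.le_sqrt_of_sq_le ?_
  norm_num
  linarith [Real.pi_gt_three]

lemma one_sub_exp_neg_le_rpow {α w : ℝ} (hα : 0 ≤ α) (hα1 : α ≤ 1) (hw : 0 ≤ w) :
    1 - Real.exp (-w) ≤ w ^ α := by
  rcases le_total w 1 with h | h
  · calc 1 - Real.exp (-w) ≤ w ^ (1 : ℝ) := by
          rw [Real.rpow_one]
          linarith [Real.one_sub_le_exp_neg w]
      _ ≤ w ^ α := Real.rpow_le_rpow_of_exponent_ge' hw h hα hα1
  · linarith [Real.one_le_rpow h hα, Real.exp_pos (-w)]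

lemma rpow_sq_div_le {v : ℝ} (hv : 0 < v) (d : ℝ) :
    (d ^ 2 / (4 * v)) ^ (1 / 4 : ℝ) ≤ √|d| * v ^ (-(1 / 4) : ℝ) := by
  calc (d ^ 2 / (4 * v)) ^ (1 / 4 : ℝ) ≤ (|d| ^ 2 * v⁻¹) ^ (1 / 4 : ℝ) := by
        rw [sq_abs, ← div_eq_mul_inv]
        gcongr
        linarith
    _ = √|d| * v ^ (-(1 / 4) : ℝ) := by
        rw [Real.mul_rpow (by positivity) (by positivity), ← Real.rpow_natCast,
          ← Real.rpow_mul (abs_nonneg _), Real.sqrt_eq_rpow, Real.inv_rpow hv.le,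
          Real.rpow_neg hv.le]
        norm_num

lemma heatKernel_self_sub_le {v : ℝ} (hv : 0 < v) (x y : ℝ) :
    heatKernel v x x - heatKernel v x y ≤ √|x - y| * v ^ (-(3 / 4) : ℝ) := by
  have hpi := inv_sqrt_four_pi_le_half
  calc heatKernel v x x - heatKernel v x y
      = (√(4 * Real.pi))⁻¹ * v ^ (-(1 / 2) : ℝ) * (1 - Real.exp (-((x - y) ^ 2 / (4 * v)))) := by
        rw [heatKernel_eq_self_mul_exp v x y, heatKernel_self_eq_rpow hv]
        ring
    _ ≤ 1 * v ^ (-(1 / 2) : ℝ) * (√|x - y| * v ^ (-(1 / 4) : ℝ)) := by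
        gcongr
        · rw [sub_nonneg, Real.exp_le_one_iff, neg_nonpos]
          positivity
        · linarith
        · exact (one_sub_exp_neg_le_rpow (by norm_num) (by norm_num) (by positivity)).trans
            (rpow_sq_div_le hv _)
    _ = √|x - y| * v ^ (-(3 / 4) : ℝ) := by
        rw [show (-(3 / 4) : ℝ) = -(1 / 2) + -(1 / 4) by norm_num, Real.rpow_add hv]
        ring

lemma intervalIntegrable_add_self_sub_rpow {α : ℝ} (hα : -1 < α) (t : ℝ) :
    IntervalIntegrable (fun r : ℝ => (t + t - 2 * r) ^ α) volume 0 t := by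
  have h := ((intervalIntegral.intervalIntegrable_rpow' (a := 0) (b := 2 * t)
    hα).comp_mul_left (c := 2)).comp_sub_left t
  rw [zero_div, sub_zero, mul_div_cancel_left₀ _ two_ne_zero, sub_self] at h
  convert h.symm using 3
  ring

lemma integral_add_self_sub_rpow {α : ℝ} (hα : -1 < α) (t : ℝ) :
    ∫ r in (0 : ℝ)..t, (t + t - 2 * r) ^ α = (2 * t) ^ (α + 1) / (2 * (α + 1)) := by
  rw [intervalIntegral.integral_comp_sub_mul (fun v => v ^ α) two_ne_zero,
    integral_rpow (Or.inl hα), ← two_mul, sub_self, mul_zero, sub_zero,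
    Real.zero_rpow (by linarith), sub_zero, smul_eq_mul, inv_mul_eq_div, div_div,
    mul_comm 2 (α + 1)]

end HeatKernel

section StochasticConvolution

/-- The element of `L²` whose Wiener integral is the stochastic convolution at `(t, x)`, so that
`stochConv W t x` is `W (convLp t x)` by definition. -/
def convLp (t x : ℝ) : Lp ℝ 2 spaceTime := (memLp_convKernel t x).toLp (convKernel t x)

lemma integral_convKernel_mul_convKernel {s t : ℝ} (hst : s ≤ t) (x y r : ℝ) :
    ∫ z, convKernel t x (r, z) * convKernel s y (r, z)
      = (Ioo 0 s).indicator (fun r => heatKernel (t + s - 2 * r) x y) r := by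
  by_cases hr : r ∈ Ioo 0 s
  · have hrt : r < t := hr.2.trans_le hst
    rw [indicator_of_mem hr, show t + s - 2 * r = (t - r) + (s - r) by ring,
      ← integral_heatKernel_mul_heatKernel (sub_pos.2 hrt) (sub_pos.2 hr.2)]
    simp [convKernel, hr.1, hr.2, hrt]
  · have hzero : ∀ z, convKernel s y (r, z) = 0 := fun z =>
      indicator_of_notMem (fun h => hr h.1) _
    simp [indicator_of_notMem hr, hzero]

lemma integrable_convKernel_mul_convKernel (s t x y : ℝ) :
    Integrable (fun p => convKernel t x p * convKernel s y p) spaceTime :=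
  (memLp_convKernel t x).integrable_mul (memLp_convKernel s y)

lemma integrableOn_heatKernel_sub_mul {s t : ℝ} (hst : s ≤ t) (x y : ℝ) :
    IntegrableOn (fun r => heatKernel (t + s - 2 * r) x y) (Ioo 0 s) := by
  have h := (integrable_convKernel_mul_convKernel s t x y).integral_prod_left
  simp_rw [integral_convKernel_mul_convKernel hst] at h
  rwa [integrable_indicator_iff measurableSet_Ioo, IntegrableOn,
    Measure.restrict_restrict measurableSet_Ioo,
    inter_eq_self_of_subset_left (Ioo_subset_Ioi_self.trans Ioi_subset_Ici_self)] at h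

lemma inner_convLp {s t : ℝ} (hst : s ≤ t) (x y : ℝ) :
    inner ℝ (convLp t x) (convLp s y) = ∫ r in Ioo 0 s, heatKernel (t + s - 2 * r) x y := by
  have hinner : inner ℝ (convLp t x) (convLp s y)
      = ∫ p, convKernel t x p * convKernel s y p ∂spaceTime := by
    rw [L2.inner_def]
    refine integral_congr_ae ?_
    filter_upwards [(memLp_convKernel t x).coeFn_toLp, (memLp_convKernel s y).coeFn_toLp]
      with p hp hp'
    simp only [convLp, hp, hp', RCLike.inner_apply', conj_trivial]
  rw [hinner, spaceTime, integral_prod _ (integrable_convKernel_mul_convKernel s t x y)]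
  simp_rw [integral_convKernel_mul_convKernel hst]
  rw [setIntegral_indicator measurableSet_Ioo,
    inter_eq_self_of_subset_right (Ioo_subset_Ioi_self.trans Ioi_subset_Ici_self)]

lemma norm_convLp_sq {t : ℝ} (ht : 0 ≤ t) (x : ℝ) :
    ‖convLp t x‖ ^ 2 = (√(4 * Real.pi))⁻¹ * √(2 * t) := by
  rw [← real_inner_self_eq_norm_sq, inner_convLp le_rfl,
    integral_heatKernel_self ht (by linarith), ← two_mul, sub_self, Real.sqrt_zero, sub_zero]

lemma norm_convLp_sub_time_sq_le {s t : ℝ} (hs : 0 ≤ s) (hst : s ≤ t) (x : ℝ) :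
    ‖convLp t x - convLp s x‖ ^ 2 ≤ √(t - s) := by
  have concave : √(2 * t) + √(2 * s) ≤ 2 * √(t + s) := by
    refine abs_le_of_sq_le_sq' ?_ (by positivity) |>.2
    nlinarith [sq_nonneg (√(2 * t) - √(2 * s)), Real.sq_sqrt (show 0 ≤ 2 * t by linarith),
      Real.sq_sqrt (show 0 ≤ 2 * s by linarith), Real.sq_sqrt (show 0 ≤ t + s by linarith)]
  rw [norm_sub_sq_real, norm_convLp_sq (hs.trans hst), norm_convLp_sq hs, inner_convLp hst,
    integral_heatKernel_self hs (by linarith), show t + s - 2 * s = t - s by ring]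
  calc (√(4 * Real.pi))⁻¹ * √(2 * t) - 2 * ((√(4 * Real.pi))⁻¹ * (√(t + s) - √(t - s)))
        + (√(4 * Real.pi))⁻¹ * √(2 * s)
      = (√(4 * Real.pi))⁻¹ * (√(2 * t) + √(2 * s) - 2 * √(t + s) + 2 * √(t - s)) := by ring
    _ ≤ (√(4 * Real.pi))⁻¹ * (2 * √(t - s)) := by
        gcongr
        linarith
    _ ≤ 1 / 2 * (2 * √(t - s)) := by
        gcongr
        exact inv_sqrt_four_pi_le_half
    _ = √(t - s) := by ring

lemma norm_convLp_sub_space_sq_le {t : ℝ} (ht : 0 ≤ t) (x y : ℝ) :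
    ‖convLp t x - convLp t y‖ ^ 2 ≤ 4 * (2 * t) ^ (1 / 4 : ℝ) * √|x - y| := by
  have hx := integrableOn_heatKernel_sub_mul (le_refl t) x x
  have hxy := integrableOn_heatKernel_sub_mul (le_refl t) x y
  have hexp : (-1 : ℝ) < -(3 / 4) := by norm_num
  have hpow := (intervalIntegrable_iff_integrableOn_Ioo_of_le ht).1
    ((intervalIntegrable_add_self_sub_rpow hexp t).const_mul √|x - y|)
  have hnorm : ‖convLp t y‖ ^ 2 = ‖convLp t x‖ ^ 2 := by
    rw [norm_convLp_sq ht, norm_convLp_sq ht]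
  calc ‖convLp t x - convLp t y‖ ^ 2
      = 2 * ∫ r in Ioo 0 t, (heatKernel (t + t - 2 * r) x x - heatKernel (t + t - 2 * r) x y) := by
        rw [norm_sub_sq_real, hnorm, ← real_inner_self_eq_norm_sq, inner_convLp le_rfl,
          inner_convLp le_rfl, integral_sub hx hxy]
        ring
    _ ≤ 2 * ∫ r in Ioo 0 t, √|x - y| * (t + t - 2 * r) ^ (-(3 / 4) : ℝ) := by
        gcongr ?_ * ?_
        exact setIntegral_mono_on (hx.sub hxy) hpow measurableSet_Ioo fun r hr =>
          heatKernel_self_sub_le (by linarith [hr.2]) x y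
    _ = 4 * (2 * t) ^ (1 / 4 : ℝ) * √|x - y| := by
        rw [integral_const_mul, ← integral_Ioc_eq_integral_Ioo,
          ← intervalIntegral.integral_of_le ht, integral_add_self_sub_rpow hexp]
        norm_num
        ring

lemma norm_convLp_sub_sq_le {s t : ℝ} (hs : 0 ≤ s) (hs1 : s ≤ 1) (ht : 0 ≤ t) (x y : ℝ) :
    ‖convLp t x - convLp s y‖ ^ 2 ≤ 16 * (√|t - s| + √|x - y|) := by
  have htime : ‖convLp t x - convLp s x‖ ^ 2 ≤ √|t - s| := by
    rcases le_total s t with h | h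
    · rw [abs_of_nonneg (sub_nonneg.2 h)]
      exact norm_convLp_sub_time_sq_le hs h x
    · rw [abs_sub_comm, abs_of_nonneg (sub_nonneg.2 h), norm_sub_rev]
      exact norm_convLp_sub_time_sq_le ht h x
  have hspace : ‖convLp s x - convLp s y‖ ^ 2 ≤ 8 * √|x - y| := by
    have hpow : (2 * s) ^ (1 / 4 : ℝ) ≤ 2 := calc
      (2 * s) ^ (1 / 4 : ℝ) ≤ 2 ^ (1 / 4 : ℝ) := by
        gcongr
        linarith
      _ ≤ 2 ^ (1 : ℝ) := by
        gcongr <;> norm_num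
      _ = 2 := Real.rpow_one 2
    refine (norm_convLp_sub_space_sq_le hs x y).trans ?_
    gcongr
    linarith
  calc ‖convLp t x - convLp s y‖ ^ 2
      ≤ (‖convLp t x - convLp s x‖ + ‖convLp s x - convLp s y‖) ^ 2 := by
        gcongr
        exact norm_sub_le_norm_sub_add_norm_sub _ _ _
    _ ≤ 2 * (‖convLp t x - convLp s x‖ ^ 2 + ‖convLp s x - convLp s y‖ ^ 2) := add_sq_le
    _ ≤ 16 * (√|t - s| + √|x - y|) := by linarith [Real.sqrt_nonneg |t - s|]

end StochasticConvolution

section Box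

/-- The space-time box `(0, h) × (a, a + 1)`. -/
def box (h a : ℝ) : Set (ℝ × ℝ) := Ioo 0 h ×ˢ Ioo a (a + 1)

lemma measurableSet_box (h a : ℝ) : MeasurableSet (box h a) :=
  measurableSet_Ioo.prod measurableSet_Ioo

lemma spaceTime_box (h a : ℝ) : spaceTime (box h a) = ENNReal.ofReal h := by
  rw [spaceTime, box, Measure.prod_prod, Measure.restrict_apply measurableSet_Ioo,
    inter_eq_self_of_subset_left (Ioo_subset_Ioi_self.trans Ioi_subset_Ici_self)]
  simp

lemma spaceTime_box_ne_top (h a : ℝ) : spaceTime (box h a) ≠ ∞ := by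
  simp [spaceTime_box]

/-- The indicator of a box, as an element of `L²`. -/
def boxLp (h a : ℝ) : Lp ℝ 2 spaceTime :=
  indicatorConstLp 2 (measurableSet_box h a) (spaceTime_box_ne_top h a) 1

lemma norm_boxLp {h : ℝ} (hh : 0 ≤ h) (a : ℝ) : ‖boxLp h a‖ = √h := by
  rw [boxLp, norm_indicatorConstLp two_ne_zero ENNReal.ofNat_ne_top, measureReal_def,
    spaceTime_box, ENNReal.toReal_ofReal hh, Real.sqrt_eq_rpow]
  simp

lemma pairwise_inner_boxLp_eq_zero (h : ℝ) :
    Pairwise fun i j : ℕ => inner ℝ (boxLp h i) (boxLp h j) = 0 := by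
  intro i j hij
  have hdisj : box h i ∩ box h j = ∅ := by
    rw [← disjoint_iff_inter_eq_empty, box, box, Set.disjoint_prod]
    have hcast : (i : ℤ) ≠ j := Nat.cast_injective.ne hij
    exact Or.inr (by simpa using pairwise_disjoint_Ioo_intCast ℝ hcast)
  rw [boxLp, boxLp, L2.real_inner_indicatorConstLp_one_indicatorConstLp_one _ _
    (spaceTime_box_ne_top h i) (spaceTime_box_ne_top h j), hdisj, measureReal_empty]

lemma convLp_ae_eq_heatKernel_on_box {h t : ℝ} (hht : h ≤ t) (a x : ℝ) :
    convLp t x =ᵐ[spaceTime.restrict (box h a)] fun p => heatKernel (t - p.1) x p.2 := by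
  filter_upwards [ae_restrict_of_ae (memLp_convKernel t x).coeFn_toLp,
    ae_restrict_mem (measurableSet_box h a)] with p hp hmem
  rw [convLp, hp, convKernel, indicator_of_mem]
  exact ⟨⟨hmem.1.1, hmem.1.2.trans_le hht⟩, mem_univ _⟩

lemma le_inner_boxLp_convLp {a h t t₁ x : ℝ} (hh : 0 < h) (ht : 2 * h ≤ t) (ht₁ : t ≤ t₁)
    (hx : x ∈ Icc a (a + 1)) :
    (√(4 * Real.pi * t₁))⁻¹ * Real.exp (-(1 / (4 * h))) * h
      ≤ inner ℝ (boxLp h a) (convLp t x) := by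
  have hae := convLp_ae_eq_heatKernel_on_box (by linarith : h ≤ t) a x
  have hint : IntegrableOn (fun p => heatKernel (t - p.1) x p.2) (box h a) spaceTime :=
    (integrableOn_Lp_of_measure_ne_top (convLp t x) fact_one_le_two_ennreal.elim
      (spaceTime_box_ne_top h a)).congr hae
  have hvol : spaceTime.real (box h a) = h := by
    rw [measureReal_def, spaceTime_box, ENNReal.toReal_ofReal hh.le]
  rw [boxLp, L2.inner_indicatorConstLp_one, integral_congr_ae hae]
  refine le_of_eq_of_le (by rw [hvol]) (setIntegral_ge_of_const_le_real (measurableSet_box h a)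
    (spaceTime_box_ne_top h a) (fun p hp => ?_) hint)
  obtain ⟨⟨hp0, hph⟩, hpa, hpa1⟩ := hp
  have hdist : |x - p.2| ≤ 1 := abs_le.2 ⟨by linarith [hx.1], by linarith [hx.2]⟩
  simpa only [one_pow] using le_heatKernel (v := t - p.1) hh (by linarith) (by linarith) hdist

end Box

section Window

lemma norm_convLp_sq_le_one {t : ℝ} (ht : 0 ≤ t) (ht1 : t ≤ 1) (x : ℝ) : ‖convLp t x‖ ^ 2 ≤ 1 := by
  have hsqrt : √(2 * t) ≤ 2 := Real.sqrt_le_iff.2 ⟨by norm_num, by linarith⟩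
  calc ‖convLp t x‖ ^ 2 = (√(4 * Real.pi))⁻¹ * √(2 * t) := norm_convLp_sq ht x
    _ ≤ 1 / 2 * 2 := by
        gcongr
        exact inv_sqrt_four_pi_le_half
    _ = 1 := by norm_num

lemma isQuarterHolder_convLp {t₀ t₁ : ℝ} (ht₀ : 0 ≤ t₀) (ht₀₁ : t₀ ≤ t₁) (ht₁ : t₁ ≤ 1) (a : ℝ) :
    IsQuarterHolder 16 fun p => convLp (t₀ + (t₁ - t₀) * p.1) (a + p.2) := by
  intro p hp q hq
  have hq1 : (t₁ - t₀) * q.1 ≤ t₁ - t₀ := mul_le_of_le_one_right (by linarith) hq.1.2.le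
  have hp0 : 0 ≤ (t₁ - t₀) * p.1 := mul_nonneg (by linarith) hp.1.1
  have hq0 : 0 ≤ (t₁ - t₀) * q.1 := mul_nonneg (by linarith) hq.1.1
  refine (norm_convLp_sub_sq_le (by linarith) (by linarith) (by linarith) _ _).trans ?_
  rw [add_sub_add_left_eq_sub, add_sub_add_left_eq_sub, ← mul_sub, abs_mul,
    abs_of_nonneg (sub_nonneg.2 ht₀₁)]
  gcongr
  exact mul_le_of_le_one_left (abs_nonneg _) (by linarith)

variable {Ω : Type*} {mΩ : MeasurableSpace Ω} {P : Measure Ω} [IsProbabilityMeasure P]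
  {W : Lp ℝ 2 spaceTime → Ω → ℝ}

theorem IsIsonormal.exists_event_forall_ae_le_stochConv (hW : IsIsonormal W P) {t₀ t₁ : ℝ}
    (ht₀ : 0 < t₀) (ht₀₁ : t₀ < t₁) (ht₁ : t₁ ≤ 1) (m : ℝ) {B : Set Ω} (hB : MeasurableSet B)
    (hPB : P B ≠ 0) :
    ∃ a : ℝ, ∃ A ⊆ B, MeasurableSet A ∧ P A ≠ 0 ∧ ∀ t ∈ Ico t₀ t₁, ∀ x ∈ Ico a (a + 1),
      ∀ᵐ ω ∂P, ω ∈ A → m ≤ stochConv W t x ω := by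
  have hlen : 0 < t₁ - t₀ := sub_pos.2 ht₀₁
  have hh : 0 < t₀ / 2 := half_pos ht₀
  let g : ℕ → ℝ × ℝ → Lp ℝ 2 spaceTime := fun n p => convLp (t₀ + (t₁ - t₀) * p.1) (n + p.2)
  have hg0 : ∀ n, ‖g n 0‖ ^ 2 ≤ 16 := fun n =>
    (norm_convLp_sq_le_one (by simpa using ht₀.le) (by simpa using ht₀₁.le.trans ht₁) _).trans
      (by norm_num)
  let c : ℝ := (√(4 * Real.pi * t₁))⁻¹ * Real.exp (-(1 / (4 * (t₀ / 2)))) * (t₀ / 2)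
  have hc : 0 < c := by
    have := ht₀.trans ht₀₁
    positivity
  have hinner : ∀ n : ℕ, ∀ p ∈ unitSquare, c ≤ inner ℝ (boxLp (t₀ / 2) n) (g n p) := by
    intro n p ⟨hp₁, hp₂⟩
    have h0 : 0 ≤ (t₁ - t₀) * p.1 := mul_nonneg hlen.le hp₁.1
    have h1 : (t₁ - t₀) * p.1 ≤ t₁ - t₀ := mul_le_of_le_one_right hlen.le hp₁.2.le
    exact le_inner_boxLp_convLp hh (by linarith) (by linarith)
      ⟨by linarith [hp₂.1], by linarith [hp₂.2]⟩
  obtain ⟨n, A, hAB, hA, hPA, hle⟩ := hW.exists_event_forall_ae_le (by norm_num)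
    (pairwise_inner_boxLp_eq_zero (t₀ / 2)) (Real.sqrt_pos.2 hh) (fun n => norm_boxLp hh.le n)
    hg0 (fun n => isQuarterHolder_convLp ht₀.le ht₀₁.le ht₁ n) hc hinner m hB hPB
  refine ⟨n, A, hAB, hA, hPA, fun t ht x hx => ?_⟩
  have hmem : ((t - t₀) / (t₁ - t₀), x - n) ∈ unitSquare :=
    ⟨⟨div_nonneg (sub_nonneg.2 ht.1) hlen.le, (div_lt_one hlen).2 (by linarith [ht.2])⟩,
      sub_nonneg.2 hx.1, by linarith [hx.2]⟩
  have hg : g n ((t - t₀) / (t₁ - t₀), x - n) = convLp t x := by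
    simp only [g, mul_div_cancel₀ _ hlen.ne', add_sub_cancel]
  have hle_tx := hle _ hmem
  rwa [hg] at hle_tx

end Window

section Reaction

/-- A lower bound for the heat mass of a unit interval seen from one of its points, uniformly up
to time `1`. The interval contains a subinterval of length `√t / 2` within distance `√t` of the
point, on which the heat kernel at time `t` is at least `e⁻¹ / √(4 π t)`. -/
def massBound : ℝ := Real.exp (-1) * (√(4 * Real.pi))⁻¹ / 2

lemma massBound_pos : 0 < massBound := by
  unfold massBound
  positivity

lemma continuous_heatKernel (t x : ℝ) : Continuous (heatKernel t x) := by
  unfold heatKernel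
  fun_prop

lemma integrableOn_heatKernel_Ioo (t x a b : ℝ) : IntegrableOn (heatKernel t x) (Ioo a b) :=
  ((continuous_heatKernel t x).integrableOn_Icc).mono_set Ioo_subset_Icc_self

lemma exists_Ioo_subset_forall_abs_sub_le {a x ε : ℝ} (hε : 0 ≤ ε) (hε1 : ε ≤ 1)
    (hx : x ∈ Icc a (a + 1)) :
    ∃ l, Ioo l (l + ε / 2) ⊆ Ioo a (a + 1) ∧ ∀ y ∈ Ioo l (l + ε / 2), |x - y| ≤ ε := by
  obtain ⟨hax, hxa⟩ := hx
  rcases le_total x (a + 1 / 2) with h | h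
  · exact ⟨x, Ioo_subset_Ioo hax (by linarith),
      fun y hy => abs_le.2 ⟨by linarith [hy.2], by linarith [hy.1]⟩⟩
  · exact ⟨x - ε / 2, Ioo_subset_Ioo (by linarith) (by linarith),
      fun y hy => abs_le.2 ⟨by linarith [hy.2], by linarith [hy.1]⟩⟩

lemma massBound_le_integral_heatKernel {t a x : ℝ} (ht : 0 < t) (ht1 : t ≤ 1)
    (hx : x ∈ Icc a (a + 1)) : massBound ≤ ∫ y in Ioo a (a + 1), heatKernel t x y := by
  obtain ⟨l, hsub, hdist⟩ :=
    exists_Ioo_subset_forall_abs_sub_le (Real.sqrt_nonneg t) (Real.sqrt_le_one.2 ht1) hx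
  have hlow : ∀ y ∈ Ioo l (l + √t / 2),
      (√(4 * Real.pi * t))⁻¹ * Real.exp (-1) ≤ heatKernel t x y := by
    intro y hy
    refine le_trans ?_ (le_heatKernel ht le_rfl le_rfl (hdist y hy))
    gcongr
    rw [Real.sq_sqrt ht.le, div_le_one (by positivity)]
    linarith
  calc massBound
      = (√(4 * Real.pi * t))⁻¹ * Real.exp (-1) * volume.real (Ioo l (l + √t / 2)) := by
        rw [Real.volume_real_Ioo_of_le (by linarith [Real.sqrt_nonneg t]), add_sub_cancel_left,
          Real.sqrt_mul (by positivity), massBound]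
        field_simp
    _ ≤ ∫ y in Ioo l (l + √t / 2), heatKernel t x y :=
        setIntegral_ge_of_const_le_real measurableSet_Ioo (by simp) hlow
          (integrableOn_heatKernel_Ioo _ _ _ _)
    _ ≤ ∫ y in Ioo a (a + 1), heatKernel t x y :=
        setIntegral_mono_set (integrableOn_heatKernel_Ioo _ _ _ _)
          (Eventually.of_forall fun y => heatKernel_nonneg _ _ _) hsub.eventuallyLE

/-- The reaction term `∫₀ᵗ ∫ G(t - s, x, y) b(v(s, y)) dy ds` of the mild equation along the
path `v`. -/
def reactionTerm (b : ℝ → ℝ) (v : ℝ≥0 → ℝ → ℝ) (t : ℝ≥0) (x : ℝ) : ℝ :=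
  ∫ s in (0 : ℝ)..t, ∫ y, heatKernel (t - s) x y * b (v s.toNNReal y)

variable {σ : ℝ} {b u₀ : ℝ → ℝ} {v : ℝ≥0 → ℝ → ℝ} {z : ℝ} {t : ℝ≥0} {x : ℝ}

lemma MildEquationAt.reactionTerm_add_le (hu₀ : ∀ y, 0 ≤ u₀ y)
    (h : MildEquationAt σ b u₀ v z t x) : reactionTerm b v t x + σ * z ≤ v t x := by
  have hheat : 0 ≤ ∫ y, heatKernel t x y * u₀ y :=
    integral_nonneg fun y => mul_nonneg (heatKernel_nonneg _ _ _) (hu₀ y)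
  rw [h.2.2, reactionTerm]
  linarith

lemma reactionTerm_nonneg (hb : ∀ r, 0 ≤ b r) (v : ℝ≥0 → ℝ → ℝ) (t : ℝ≥0) (x : ℝ) :
    0 ≤ reactionTerm b v t x :=
  intervalIntegral.integral_nonneg t.2 fun _ _ =>
    integral_nonneg fun _ => mul_nonneg (heatKernel_nonneg _ _ _) (hb _)

lemma massBound_mul_le_integral_heatKernel_mul {w : ℝ → ℝ} {r a M x : ℝ} (hb : ∀ r, 0 ≤ b r)
    (hmono : MonotoneOn b (Ioi 0)) (hM : 0 < M) (hr : 0 < r) (hr1 : r ≤ 1)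
    (hx : x ∈ Icc a (a + 1)) (hint : Integrable fun y => heatKernel r x y * b (w y))
    (hw : ∀ᵐ y, y ∈ Ioo a (a + 1) → M ≤ w y) :
    massBound * b M ≤ ∫ y, heatKernel r x y * b (w y) := by
  calc massBound * b M ≤ (∫ y in Ioo a (a + 1), heatKernel r x y) * b M := by
        gcongr
        · exact hb M
        · exact massBound_le_integral_heatKernel hr hr1 hx
    _ = ∫ y in Ioo a (a + 1), heatKernel r x y * b M := (integral_mul_const _ _).symm
    _ ≤ ∫ y in Ioo a (a + 1), heatKernel r x y * b (w y) := by
        refine setIntegral_mono_on_ae ((integrableOn_heatKernel_Ioo _ _ _ _).mul_const _)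
          hint.integrableOn measurableSet_Ioo ?_
        filter_upwards [hw] with y hy hya
        exact mul_le_mul_of_nonneg_left (hmono hM (hM.trans_le (hy hya)) (hy hya))
          (heatKernel_nonneg _ _ _)
    _ ≤ ∫ y, heatKernel r x y * b (w y) := setIntegral_le_integral hint
        (Eventually.of_forall fun y => mul_nonneg (heatKernel_nonneg _ _ _) (hb _))

lemma MildEquationAt.le_reactionTerm {a M s₀ s₁ : ℝ} (hb : ∀ r, 0 ≤ b r)
    (hmono : MonotoneOn b (Ioi 0)) (hM : 0 < M) (hs₀ : 0 ≤ s₀) (hs₀₁ : s₀ ≤ s₁) (hs₁t : s₁ ≤ t)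
    (ht1 : (t : ℝ) ≤ 1) (hx : x ∈ Icc a (a + 1))
    (hv : ∀ᵐ s : ℝ, ∀ᵐ y : ℝ, s ∈ Ioo s₀ s₁ → y ∈ Ioo a (a + 1) → M ≤ v s.toNNReal y)
    (h : MildEquationAt σ b u₀ v z t x) :
    massBound * (s₁ - s₀) * b M ≤ reactionTerm b v t x := by
  set f : ℝ → ℝ := fun s => ∫ y, heatKernel (t - s) x y * b (v s.toNNReal y)
  have hf0 : ∀ s, 0 ≤ f s := fun s =>
    integral_nonneg fun y => mul_nonneg (heatKernel_nonneg _ _ _) (hb _)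
  have hint := h.2.1
  rw [IntegrableOn, Measure.volume_eq_prod, ← Measure.prod_restrict, Measure.restrict_univ] at hint
  have hfint : IntegrableOn f (Ioo 0 (t : ℝ)) := hint.integral_prod_left
  have hsub : Ioo s₀ s₁ ⊆ Ioo 0 (t : ℝ) := Ioo_subset_Ioo hs₀ hs₁t
  have hlow : ∀ᵐ s : ℝ, s ∈ Ioo s₀ s₁ → massBound * b M ≤ f s := by
    filter_upwards [(ae_restrict_iff' measurableSet_Ioo).1 hint.prod_right_ae, hv]
      with s hints hvs hs
    exact massBound_mul_le_integral_heatKernel_mul hb hmono hM (sub_pos.2 (hsub hs).2)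
      (by linarith [hs.1]) hx (hints (hsub hs)) (hvs.mono fun y hy => hy hs)
  calc massBound * (s₁ - s₀) * b M = ∫ _ in Ioo s₀ s₁, massBound * b M := by
        rw [setIntegral_const, Real.volume_real_Ioo_of_le hs₀₁, smul_eq_mul]
        ring
    _ ≤ ∫ s in Ioo s₀ s₁, f s :=
        setIntegral_mono_on_ae (integrableOn_const (by simp)) (hfint.mono_set hsub)
          measurableSet_Ioo hlow
    _ ≤ ∫ s in Ioo 0 (t : ℝ), f s :=
        setIntegral_mono_set hfint (Eventually.of_forall hf0) hsub.eventuallyLE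
    _ = reactionTerm b v t x := by
        rw [reactionTerm, intervalIntegral.integral_of_le t.coe_nonneg,
          integral_Ioc_eq_integral_Ioo]

end Reaction

section Osgood

variable {b : ℝ → ℝ}

lemma pos_of_lintegral_inv_lt_top {a : ℝ} (hmono : MonotoneOn b (Ioi a))
    (hfin : ∫⁻ s in Ioi a, (ENNReal.ofReal (b s))⁻¹ < ∞) {s : ℝ} (hs : a < s) : 0 < b s := by
  by_contra! hbs
  have htop : ∫⁻ r in Ioo a s, (ENNReal.ofReal (b r))⁻¹ = ∞ := calc
    ∫⁻ r in Ioo a s, (ENNReal.ofReal (b r))⁻¹ = ∫⁻ _ in Ioo a s, ∞ := by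
        refine setLIntegral_congr_fun measurableSet_Ioo fun r hr => ?_
        have hbr : b r ≤ 0 := (hmono hr.1 hs hr.2.le).trans hbs
        simp [ENNReal.ofReal_of_nonpos hbr]
    _ = ∞ := by
        rw [setLIntegral_const, Real.volume_Ioo, ENNReal.top_mul]
        simpa using hs
  exact (lintegral_mono_set Ioo_subset_Ioi_self).not_gt (hfin.trans_eq htop.symm)

lemma ofReal_mul_inv_le_setLIntegral_Ioc {r : ℝ} (hr : 0 < r) (hmono : MonotoneOn b (Ioi 0)) :
    ENNReal.ofReal r * (ENNReal.ofReal (b (2 * r)))⁻¹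
      ≤ ∫⁻ s in Ioc r (2 * r), (ENNReal.ofReal (b s))⁻¹ := by
  calc ENNReal.ofReal r * (ENNReal.ofReal (b (2 * r)))⁻¹
      = ∫⁻ _ in Ioc r (2 * r), (ENNReal.ofReal (b (2 * r)))⁻¹ := by
        rw [setLIntegral_const, Real.volume_Ioc, mul_comm]
        congr 2
        ring
    _ ≤ ∫⁻ s in Ioc r (2 * r), (ENNReal.ofReal (b s))⁻¹ := by
        refine setLIntegral_mono' measurableSet_Ioc fun s hs => ?_
        have hs0 : 0 < s := hr.trans hs.1
        exact ENNReal.inv_le_inv.2 (ENNReal.ofReal_le_ofReal (hmono hs0 (hs0.trans_le hs.2) hs.2))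

lemma tsum_dyadic_ne_top (hmono : MonotoneOn b (Ioi 0)) {a : ℝ}
    (hfin : ∫⁻ s in Ioi a, (ENNReal.ofReal (b s))⁻¹ < ∞) {k₀ : ℕ} (hk₀ : a ≤ 2 ^ k₀) :
    ∑' k, ENNReal.ofReal (2 ^ (k₀ + k)) * (ENNReal.ofReal (b (2 ^ (k₀ + k + 1))))⁻¹ ≠ ∞ := by
  have hpow : Monotone fun k : ℕ => (2 : ℝ) ^ (k₀ + k) := fun i j hij =>
    pow_le_pow_right₀ one_le_two (by omega)
  refine ne_top_of_le_ne_top hfin.ne ?_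
  calc ∑' k, ENNReal.ofReal (2 ^ (k₀ + k)) * (ENNReal.ofReal (b (2 ^ (k₀ + k + 1))))⁻¹
      ≤ ∑' k, ∫⁻ s in Ioc (2 ^ (k₀ + k) : ℝ) (2 ^ (k₀ + (k + 1))), (ENNReal.ofReal (b s))⁻¹ := by
        refine ENNReal.tsum_le_tsum fun k => ?_
        rw [← add_assoc, pow_succ']
        exact ofReal_mul_inv_le_setLIntegral_Ioc (by positivity) hmono
    _ = ∫⁻ s in ⋃ k : ℕ, Ioc (2 ^ (k₀ + k) : ℝ) (2 ^ (k₀ + (k + 1))), (ENNReal.ofReal (b s))⁻¹ :=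
        (lintegral_iUnion (fun k => measurableSet_Ioc)
          (by simpa using hpow.pairwise_disjoint_on_Ioc_succ) _).symm
    _ ≤ ∫⁻ s in Ioi a, (ENNReal.ofReal (b s))⁻¹ :=
        lintegral_mono_set (iUnion_subset fun k s hs =>
          (hk₀.trans (hpow (Nat.zero_le k))).trans_lt hs.1)

lemma Osgood.exists_summable_dyadic (h : Osgood b) (hmono : MonotoneOn b (Ioi 0)) :
    ∃ k₀ : ℕ, (∀ k, 0 < b (2 ^ (k₀ + k))) ∧
      Summable fun k => (2 : ℝ) ^ (k₀ + k) / b (2 ^ (k₀ + k)) := by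
  obtain ⟨a, ha, hfin⟩ := h
  obtain ⟨k₀, hk₀⟩ := pow_unbounded_of_one_lt a (one_lt_two (α := ℝ))
  have hpos : ∀ k, 0 < b (2 ^ (k₀ + k)) := fun k =>
    pos_of_lintegral_inv_lt_top (hmono.mono (Ioi_subset_Ioi ha.le)) hfin
      (hk₀.trans_le (pow_le_pow_right₀ one_le_two (Nat.le_add_right _ _)))
  refine ⟨k₀, hpos, (summable_nat_add_iff 1).1 ?_⟩
  refine ((ENNReal.summable_toReal (tsum_dyadic_ne_top hmono hfin hk₀.le)).mul_left 2).congr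
    fun k => ?_
  rw [ENNReal.toReal_mul, ENNReal.toReal_inv, ENNReal.toReal_ofReal (by positivity),
    add_assoc k₀ k 1, ENNReal.toReal_ofReal (hpos (k + 1)).le, ← add_assoc, pow_succ]
  ring

lemma Osgood.exists_levels (h : Osgood b) (hmono : MonotoneOn b (Ioi 0)) {c t₀ t₁ : ℝ} (hc : 0 < c)
    (ht : t₀ < t₁) :
    ∃ M T : ℕ → ℝ, (∀ k, 0 < M k) ∧ Tendsto M atTop atTop ∧ T 0 = t₀ ∧ Monotone T ∧
      (∀ k, T k ≤ t₁) ∧ ∀ k, c * (T (k + 1) - T k) * b (M k) = M (k + 1) := by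
  obtain ⟨k₀, hpos, hsum⟩ := h.exists_summable_dyadic hmono
  set f : ℕ → ℝ := fun k => 2 / c * ((2 : ℝ) ^ (k₀ + k) / b (2 ^ (k₀ + k))) with hf
  have hf0 : ∀ k, 0 ≤ f k := fun k =>
    mul_nonneg (by positivity) (div_nonneg (by positivity) (hpos k).le)
  obtain ⟨N, hN⟩ := ((tendsto_sum_nat_add f).eventually (gt_mem_nhds (sub_pos.2 ht))).exists
  have hsumN : Summable fun k => f (k + N) := (summable_nat_add_iff N).2 (hsum.mul_left _)
  refine ⟨fun k => 2 ^ (k₀ + (k + N)), fun k => t₀ + ∑ l ∈ Finset.range k, f (l + N),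
    fun k => by positivity, ?_, by simp, ?_, fun k => ?_, fun k => ?_⟩
  · exact (tendsto_pow_atTop_atTop_of_one_lt one_lt_two).comp
      (tendsto_atTop_mono (fun k => by rw [id]; omega) tendsto_id)
  · refine monotone_nat_of_le_succ fun k => ?_
    rw [Finset.sum_range_succ]
    linarith [hf0 (k + N)]
  · linarith [hsumN.sum_le_tsum (Finset.range k) fun l _ => hf0 _]
  · have := hpos (k + N)
    simp only [Finset.sum_range_succ, ← add_assoc t₀, add_sub_cancel_left, hf]
    rw [show k₀ + (k + 1 + N) = k₀ + (k + N) + 1 by ring, pow_succ]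
    field_simp

lemma osgood_of_eq_rpow {η : ℝ} (hη : 0 < η) (hb : ∀ r, 0 ≤ r → b r = r ^ (1 + η)) : Osgood b := by
  refine ⟨1, one_pos, ?_⟩
  have hint := integrableOn_Ioi_rpow_of_lt (show -(1 + η) < -1 by linarith) one_pos
  refine lt_of_eq_of_lt (setLIntegral_congr_fun measurableSet_Ioi fun s hs => ?_)
    hint.lintegral_lt_top
  have hs0 : 0 < s := one_pos.trans hs
  rw [hb s hs0.le, ← ENNReal.ofReal_inv_of_pos (Real.rpow_pos_of_pos hs0 _),
    Real.rpow_neg hs0.le]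

lemma monotoneOn_of_eq_rpow {p : ℝ} (hp : 0 ≤ p) (hb : ∀ r, 0 ≤ r → b r = r ^ p) :
    MonotoneOn b (Ici 0) := by
  intro r hr s hs hrs
  rw [hb r hr, hb s hs]
  exact Real.rpow_le_rpow hr hrs hp

end Osgood

section BlowUp

variable {Ω : Type*} {mΩ : MeasurableSpace Ω} {P : Measure Ω}

/-- On the event `A`, the random field `u` is at least `M` at every point of the window
`[s, t) × [a, a + 1)`; the exceptional null set may depend on the point. -/
def LeOnWindow (P : Measure Ω) (A : Set Ω) (s t a M : ℝ) (u : ℝ≥0 → ℝ → Ω → ℝ) : Prop :=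
  ∀ r : ℝ≥0, (r : ℝ) ∈ Ico s t → ∀ x ∈ Ico a (a + 1), ∀ᵐ ω ∂P, ω ∈ A → M ≤ u r x ω

lemma LeOnWindow.ae_ae_ae [SFinite P] {u : ℝ≥0 → ℝ → Ω → ℝ} {A : Set Ω} {s t a M : ℝ}
    (h : LeOnWindow P A s t a M u) (hu : Measurable fun p : ℝ≥0 × ℝ × Ω => u p.1 p.2.1 p.2.2)
    (hA : MeasurableSet A) (hs : 0 ≤ s) :
    ∀ᵐ ω ∂P, ω ∈ A →
      ∀ᵐ r : ℝ, ∀ᵐ y : ℝ, r ∈ Ioo s t → y ∈ Ioo a (a + 1) → M ≤ u r.toNNReal y ω := by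
  let p : ℝ × ℝ → Ω → Prop := fun q ω =>
    q ∈ Ioo s t ×ˢ Ioo a (a + 1) → ω ∈ A → M ≤ u q.1.toNNReal q.2 ω
  have hmeas : MeasurableSet {x : (ℝ × ℝ) × Ω | p x.1 x.2} := by
    have hu' : Measurable fun x : (ℝ × ℝ) × Ω => u x.1.1.toNNReal x.1.2 x.2 :=
      hu.comp (f := fun x : (ℝ × ℝ) × Ω => (x.1.1.toNNReal, x.1.2, x.2)) (by fun_prop)
    exact (measurable_fst (measurableSet_Ioo.prod measurableSet_Ioo)).imp
      ((measurable_snd hA).imp (measurableSet_le measurable_const hu'))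
  have hae : ∀ᵐ q : ℝ × ℝ, ∀ᵐ ω ∂P, p q ω := by
    refine Eventually.of_forall fun q => ?_
    by_cases hq : q ∈ Ioo s t ×ˢ Ioo a (a + 1)
    · have hq1 : (q.1.toNNReal : ℝ) = q.1 := Real.coe_toNNReal _ (hs.trans hq.1.1.le)
      filter_upwards [h q.1.toNNReal (hq1.symm ▸ Ioo_subset_Ico_self hq.1) q.2
        (Ioo_subset_Ico_self hq.2)] with ω hω _
      exact hω
    · exact Eventually.of_forall fun ω hq' => absurd hq' hq
  filter_upwards [(Measure.ae_ae_comm hmeas).1 hae] with ω hω hωA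
  filter_upwards [Measure.ae_ae_of_ae_prod hω] with r hr
  filter_upwards [hr] with y hy hr' hy'
  exact hy ⟨hr', hy'⟩ hωA

variable {ℱ : Filtration ℝ≥0 mΩ} {W : Lp ℝ 2 spaceTime → Ω → ℝ} {σ : ℝ} {b u₀ : ℝ → ℝ}
  {u : ℝ≥0 → ℝ → Ω → ℝ} {τ : Ω → WithTop ℝ≥0} {A : Set Ω} {t₁ : ℝ≥0} {a : ℝ}

namespace IsLocalSolution

lemma ae_mildEquationAt (hu : IsLocalSolution W ℱ P σ b u₀ u τ)
    (hAτ : ∀ ω ∈ A, (t₁ : WithTop ℝ≥0) < τ ω) {t : ℝ≥0} (ht : 0 < t) (ht₁ : t < t₁) (x : ℝ) :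
    ∀ᵐ ω ∂P, ω ∈ A →
      MildEquationAt σ b u₀ (fun s y => u s y ω) (stochConv W t x ω) t x := by
  filter_upwards [hu.mild t ht x] with ω hω hωA
  exact hω ((WithTop.coe_lt_coe.2 ht₁).trans (hAτ ω hωA))

lemma leOnWindow_of_stochConv (hu : IsLocalSolution W ℱ P σ b u₀ u τ) (hσ : 0 < σ)
    (hu₀ : ∀ x, 0 ≤ u₀ x) (hb : ∀ r, 0 ≤ b r) (hAτ : ∀ ω ∈ A, (t₁ : WithTop ℝ≥0) < τ ω)
    {M t₀ : ℝ} (ht₀ : 0 < t₀)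
    (hZ : LeOnWindow P A t₀ t₁ a (M / σ) fun t x => stochConv W t x) :
    LeOnWindow P A t₀ t₁ a M u := by
  intro t ht x hx
  filter_upwards [hu.ae_mildEquationAt hAτ (ht₀.trans_le ht.1) ht.2 x, hZ t ht x hx]
    with ω hmild hnoise hωA
  have hM : M ≤ σ * stochConv W t x ω := (div_le_iff₀' hσ).1 (hnoise hωA)
  linarith [(hmild hωA).reactionTerm_add_le hu₀, reactionTerm_nonneg hb (fun s y => u s y ω) t x]

lemma leOnWindow_step [SFinite P] (hu : IsLocalSolution W ℱ P σ b u₀ u τ) (hσ : 0 < σ)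
    (hu₀ : ∀ x, 0 ≤ u₀ x) (hb : ∀ r, 0 ≤ b r) (hmono : MonotoneOn b (Ioi 0))
    (hA : MeasurableSet A) (hAτ : ∀ ω ∈ A, (t₁ : WithTop ℝ≥0) < τ ω) (ht₁ : t₁ ≤ 1)
    {M s₀ s₁ : ℝ} (hM : 0 < M) (hs₀ : 0 < s₀) (hs₀₁ : s₀ ≤ s₁)
    (hZ : LeOnWindow P A s₀ t₁ a 0 fun t x => stochConv W t x)
    (h : LeOnWindow P A s₀ t₁ a M u) :
    LeOnWindow P A s₁ t₁ a (massBound * (s₁ - s₀) * b M) u := by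
  intro t ht x hx
  have ht₀ : (t : ℝ) ∈ Ico s₀ t₁ := ⟨hs₀₁.trans ht.1, ht.2⟩
  filter_upwards [hu.ae_mildEquationAt hAτ (hs₀.trans_le ht₀.1) ht.2 x, hZ t ht₀ x hx,
    h.ae_ae_ae hu.measurable hA hs₀.le] with ω hmild hnoise hlevel hωA
  have hlevel' : ∀ᵐ s : ℝ, ∀ᵐ y : ℝ, s ∈ Ioo s₀ s₁ → y ∈ Ioo a (a + 1) →
      M ≤ u s.toNNReal y ω := by
    filter_upwards [hlevel hωA] with s hs
    filter_upwards [hs] with y hy hs' hy'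
    exact hy ⟨hs'.1, hs'.2.trans (ht.1.trans_lt ht.2)⟩ hy'
  have hreact := (hmild hωA).le_reactionTerm hb hmono hM hs₀.le hs₀₁ ht.1
    (ht.2.le.trans (by exact_mod_cast ht₁)) (Ico_subset_Icc_self hx) hlevel'
  linarith [(hmild hωA).reactionTerm_add_le hu₀, mul_nonneg hσ.le (hnoise hωA)]

lemma ae_notMem_of_levels [SFinite P] (hu : IsLocalSolution W ℱ P σ b u₀ u τ) (hσ : 0 < σ)
    (hu₀ : ∀ x, 0 ≤ u₀ x) (hb : ∀ r, 0 ≤ b r) (hmono : MonotoneOn b (Ioi 0))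
    (hA : MeasurableSet A) (hAτ : ∀ ω ∈ A, (t₁ : WithTop ℝ≥0) < τ ω) (ht₁ : t₁ ≤ 1)
    {M T : ℕ → ℝ} {t : ℝ≥0} (hM : ∀ k, 0 < M k) (hMlim : Tendsto M atTop atTop) (hT0 : 0 < T 0)
    (hTmono : Monotone T) (hTt : ∀ k, T k ≤ t) (ht : t < t₁)
    (hstep : ∀ k, massBound * (T (k + 1) - T k) * b (M k) = M (k + 1))
    (hZ : LeOnWindow P A (T 0) t₁ a (M 0 / σ) fun t x => stochConv W t x) :
    ∀ᵐ ω ∂P, ω ∉ A := by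
  have hT : ∀ k, T 0 ≤ T k := fun k => hTmono k.zero_le
  have hlevel : ∀ k, LeOnWindow P A (T k) t₁ a (M k) u := by
    intro k
    induction k with
    | zero => exact hu.leOnWindow_of_stochConv hσ hu₀ hb hAτ hT0 hZ
    | succ k ih =>
      rw [← hstep]
      refine hu.leOnWindow_step hσ hu₀ hb hmono hA hAτ ht₁ (hM k) (hT0.trans_le (hT k))
        (hTmono k.le_succ) (fun s hs x hx => ?_) ih
      filter_upwards [hZ s ⟨(hT k).trans hs.1, hs.2⟩ x hx] with ω hω hωA
      exact (div_pos (hM 0) hσ).le.trans (hω hωA)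
  filter_upwards [ae_all_iff.2 fun k => hlevel k t ⟨hTt k, ht⟩ a ⟨le_rfl, lt_add_one a⟩]
    with ω hω hωA
  obtain ⟨k, hk⟩ := (hMlim.eventually_gt_atTop (u t a ω)).exists
  exact (hω k hωA).not_gt hk

lemma ae_le_of_le_one [IsProbabilityMeasure P] (hW : IsIsonormal W P)
    (hu : IsLocalSolution W ℱ P σ b u₀ u τ) (hσ : 0 < σ) (hu₀ : ∀ x, 0 ≤ u₀ x)
    (hb : ∀ r, 0 ≤ b r) (hmono : MonotoneOn b (Ioi 0)) (hO : Osgood b) (ht₁ : 0 < t₁)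
    (ht₁1 : t₁ ≤ 1) : ∀ᵐ ω ∂P, τ ω ≤ t₁ := by
  have hquarter : ((t₁ / 4 : ℝ≥0) : ℝ) < (t₁ / 2 : ℝ≥0) := by
    push_cast
    have : (0 : ℝ) < t₁ := ht₁
    linarith
  have hhalf : t₁ / 2 < t₁ := NNReal.half_lt_self ht₁.ne'
  have ht₀ : (0 : ℝ) < (t₁ / 4 : ℝ≥0) := NNReal.coe_pos.2 (by positivity)
  obtain ⟨M, T, hM, hMlim, hT0, hTmono, hT, hstep⟩ :=
    hO.exists_levels hmono massBound_pos hquarter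
  by_contra hτ
  obtain ⟨a, A, hAB, hA, hPA, hZ⟩ := hW.exists_event_forall_ae_le_stochConv ht₀
    (hquarter.trans (NNReal.coe_lt_coe.2 hhalf)) (NNReal.coe_le_one.2 ht₁1) (M 0 / σ)
    (ℱ.le t₁ _ (hu.stopping t₁)).compl fun h => hτ (ae_iff.2 h)
  refine hPA (measure_eq_zero_iff_ae_notMem.2 ?_)
  exact hu.ae_notMem_of_levels hσ hu₀ hb hmono hA (fun ω hω => not_le.1 (hAB hω)) ht₁1 hM hMlim
    (hT0 ▸ ht₀) hTmono hT hhalf hstep fun t ht x hx => hZ t (hT0 ▸ ht) x hx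

end IsLocalSolution

lemma IsWhiteNoise.isIsonormal (hW : IsWhiteNoise W ℱ P) : IsIsonormal W P :=
  ⟨hW.measurable, hW.gaussian, hW.centered, hW.covariance⟩

end BlowUp

end StochasticHeat

end

theorem mainTheorem2_general {Ω : Type*} {mΩ : MeasurableSpace Ω} {P : Measure Ω}
    [IsProbabilityMeasure P] {ℱ : Filtration ℝ≥0 mΩ}
    {W : Lp ℝ 2 StochasticHeat.spaceTime → Ω → ℝ} (hW : StochasticHeat.IsIsonormal W P) {σ : ℝ}
    (hσ : 0 < σ) {b u₀ : ℝ → ℝ} (hu₀ : ∀ x, 0 ≤ u₀ x) (hb : ∀ r, 0 ≤ b r)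
    (hmono : MonotoneOn b (Ioi 0)) (hO : StochasticHeat.Osgood b) {u : ℝ≥0 → ℝ → Ω → ℝ}
    {τ : Ω → WithTop ℝ≥0} (hu : StochasticHeat.IsLocalSolution W ℱ P σ b u₀ u τ) :
    ∀ᵐ ω ∂P, τ ω = 0 := by
  have hτ : ∀ n : ℕ, ∀ᵐ ω ∂P, τ ω ≤ ((1 / ((n : ℝ≥0) + 1) : ℝ≥0) : WithTop ℝ≥0) := fun n =>
    hu.ae_le_of_le_one hW hσ hu₀ hb hmono hO (by positivity)
      (div_le_one_of_le₀ (by simp) (by positivity))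
  filter_upwards [ae_all_iff.2 hτ] with ω hω
  lift τ ω to ℝ≥0 using ne_top_of_le_ne_top WithTop.coe_ne_top (hω 0) with r
  have hr : r ≤ 0 := ge_of_tendsto' tendsto_one_div_add_atTop_nhds_zero_nat fun n =>
    WithTop.coe_le_coe.1 (hω n)
  exact_mod_cast le_antisymm hr bot_le

theorem mainTheorem2 {Ω : Type*} {mΩ : MeasurableSpace Ω} (P : Measure Ω) [IsProbabilityMeasure P]
    (ℱ : Filtration ℝ≥0 mΩ) (W : Lp ℝ 2 StochasticHeat.spaceTime → Ω → ℝ)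
    (hW : StochasticHeat.IsWhiteNoise W ℱ P) (σ : ℝ) (hσ : 0 < σ)
    (u₀ : ℝ → ℝ) (hu₀ : Continuous u₀) (hu₀_nonneg : ∀ x, 0 ≤ u₀ x) :
    (∀ b : ℝ → ℝ, (∀ r, 0 ≤ b r) → LocallyLipschitz b → MonotoneOn b (Ioi 0) →
      StochasticHeat.Osgood b →
      StochasticHeat.AlmostSurelyNoGlobalSolution W ℱ P σ b u₀) ∧
    (∀ η : ℝ, 0 < η → ∀ b : ℝ → ℝ, (∀ r, 0 ≤ b r) → LocallyLipschitz b →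
      (∀ r, 0 ≤ r → b r = r ^ (1 + η)) →
      StochasticHeat.AlmostSurelyNoGlobalSolution W ℱ P σ b u₀) := by
  have hblowup : ∀ b : ℝ → ℝ, (∀ r, 0 ≤ b r) → MonotoneOn b (Ioi 0) → StochasticHeat.Osgood b →
      StochasticHeat.AlmostSurelyNoGlobalSolution W ℱ P σ b u₀ := fun b hb hmono hO u τ hu =>
    (mainTheorem2_general hW.isIsonormal hσ hu₀_nonneg hb hmono hO hu).mono fun ω hω =>
      hω ▸ WithTop.top_pos
  exact ⟨fun b hb _ => hblowup b hb, fun η hη b hb _ hbη => hblowup b hb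
    ((StochasticHeat.monotoneOn_of_eq_rpow (by linarith) hbη).mono Ioi_subset_Ici_self)
    (StochasticHeat.osgood_of_eq_rpow hη hbη)⟩
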